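/- Let $k$ be a commutative ring and $\mathcal U$ a small category. A $k$-quiver $\mathcal A$ on $\mathcal U$ consists of, for every object $U$, a set of objects $\mathrm{Ob}\,\mathcal A(U)$ with $k$-modules $\mathcal A(U)(A,A')$, and, for every $u:V\to U$, a function $u^*:\mathrm{Ob}\,\mathcal A(U)\to \mathrm{Ob}\,\mathcal A(V)$ (no axioms). **Cochains.** For a $p$-simplex $\sigma=(U_0\xrightarrow{u_1}\cdots\xrightarrow{u_p}U_p)$ of the nerve put $\sigma^*=u_1^*\circ\cdots\circ u_p^*$. Let $$C_\square^{p,q,r}(\mathcal A)=\prod_{\sigma,f}\ \prod_{A_0,\dots,A_q}\mathrm{Hom}_k\Big(\bigotimes_{i=1}^q\mathcal A(U_p)(A_{i-1},A_i),\ \mathcal A(U_0)(\sigma^*A_0,f(\sigma)^*A_q)\Big),$$ where $\sigma$ runs over the $p$-simplices, $f$ over the strictly increasing maps $[r]\to[p]$ preserving end points, and $f(\sigma)$ is the $r$-simplex with vertices $U_{f(0)},\dots,U_{f(r)}$. For $\theta\in C_\square^{p,n,r}$ and $\theta_i\in C_\square^{p_{i-1},q_i,p_i}$ ($1\le i\le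 n$) there is a composite $\theta\circ(\theta_1,\dots,\theta_n)\in C_\square^{p+p_0,\sum q_i,r+p_n}$: put $(\theta_1\otimes\theta_2)^{\sigma,f}=\sum_{f=f_1f_2}\theta_1^{\sigma,f_1}\otimes\theta_2^{f_1(\sigma),f_2}$, and let $(\theta\circ(\theta_1,\dots,\theta_n))^{\sigma,f}=\theta^{\sigma',f'}\circ(\theta_1\otimes\cdots\otimes\theta_n)^{\sigma'',f''}$ if $f(r)=p$, where $\sigma'$ and $f'$ are the restrictions to the first $p$ arrows of $\sigma$ and $\sigma''$, $f''$ those to the last $p_0$ arrows, and $0$ if $f(r)\ne p$. The identities form a unit $\eta\in C_\square^{0,1,0}$. For $n=0$ the number $p_0=p_n$ is a free parameter of the composition. **Stackings.** A stacking $S$ of size $(p,q,r)$ is either the unit $\eta$, of size $(0,1,0)$, or a bottom box of size $(p',n,r')$ with a row of stackings of sizes $(p_{i-1},q_i,p_i)$, $1\le i\le n$, on top; the latter has size $(p'+p_0,\sum q_i,r'+p_n)$. Its boxes are numbered $1,\dots,N$: first the bottom box, then those of the row from left to right. Composition gives $S(\theta_1,\dots,\theta_N)$ for $\theta_i$ of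 the size of box $i$. A box $(p,q,r)$ is thin if $p=r=0$ and semi-thin if exactly one of $p,r$ is $0$; put $\mathrm{td}(p,q,r)=q-1$ if it is thin and $p-r+q$ otherwise. Let $\mathrm{td}_i$ be the value of $\mathrm{td}$ at box $i$, and $|S|=\mathrm{td}(p,q,r)-\sum_i \mathrm{td}_i$. The horizontal graph of $S$ has the boxes as vertices, with $p'$ inputs and $r'$ outputs for a box $(p',q',r')$; the graph of a box with a row on top is the box placed below the graphs of the row, the outputs of each of which are plugged in order in the inputs of the next one, and an empty row contributes $p_0$ straight wires. $S$ is thin-quadratic if $|S|=2-N$, its horizontal graph has exactly two connected components (a straight wire from an input to an output of the whole graph counts as a component), and $S$ has no semi-thin box. **Signs.** Let $d(S)$ be the sum, over the boxes $(p,n,r)$ of $S$ with row of sizes $(p_{i-1},q_i,p_i)$, of $(p_0+p_n)r+\sum_i(q_i-1)(n-i)+\sum_i(q_i-1)(p-r+p_0-p_{i-1})$, and let $t(S)=d(S)+N+\sum_i\mathrm{td}_i\cdot\#\{j>i: \text{box } j\text{ is not thin}\}$ and $e(S)=\tfrac12|S|(|S|+1)+|S|\,\mathrm{td}(p,q,r)+\sum_{i<j}\mathrm{td}_i\mathrm{td}_j$.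 **Operations.** On the totalisation $\prod_{p,q,r}C^{p,q,r}_\square(\mathcal A)$, in which $C^{p,q,r}_\square$ has degree $\mathrm{td}(p,q,r)$, the $n$-th higher Gerstenhaber brace ($n\ge2$) is $$P_n(\theta_1,\dots,\theta_n)=\sum_S(-1)^{t(S)+e(S)}S(\theta_1,\dots,\theta_n),$$ summed over the thin-quadratic stackings $S$ of $n$ boxes, where box $i$ is filled with the component of $\theta_i$ of its size. The $P_n$ are the operations of the $L_\infty$-admissible structure. The Gerstenhaber–Schack object is the part with components $C_{GS}^{0,q}=C_\square^{0,q,0}$ and $C_{GS}^{p,q}=C_\square^{p,q,1}$ for $p\ge1$; the degree $n$ part of its desuspension $s^{-1}C_{GS}(\mathcal A)$ is $\bigoplus_{p+q=n+1}C_{GS}^{p,q}$. An element $\alpha$ of degree $1$ is Maurer–Cartan if $$\mathrm{MC}(\alpha):=\sum_{n\ge2}(-1)^{n(n+1)/2}P_n(\alpha,\dots,\alpha)=0 .$$ **Theorem.** Let $\mathcal A$ be a $k$-quiver on $\mathcal U$ and let $\alpha=(m,f,c)\in C_{GS}^{0,2}\oplus C_{GS}^{1,1}\oplus C_{GS}^{2,0}$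 be an element of degree $1$ of $s^{-1}C_{GS}(\mathcal A)$. Then $P_n(\alpha,\dots,\alpha)=0$ for all $n\ge5$, all components of $\mathrm{MC}(\alpha)$ outside $C_{GS}^{0,3}$, $C_{GS}^{1,2}$, $C_{GS}^{2,1}$, $C_{GS}^{3,0}$ vanish, and, writing $m^U$, $f^u:\mathcal A(U)(A,B)\to\mathcal A(V)(u^*A,u^*B)$ for $u:V\to U$, and $c^{u,v}_A\in\mathcal A(W)(v^*u^*A,(uv)^*A)$ for $W\xrightarrow{v}V\xrightarrow{u}U$ for the components of $\alpha$: 1. $\mathrm{MC}(\alpha)_{0,3}=0$ if and only if every $m^U$ is associative; 2. $\mathrm{MC}(\alpha)_{1,2}=0$ if and only if $f^u(m^U(a,b))=m^V(f^u(a),f^u(b))$ for all $u:V\to U$ and composable $a,b$; 3. $\mathrm{MC}(\alpha)_{2,1}=0$ if and only if $m^W(f^vf^u(a),c^{u,v}_B)=m^W(c^{u,v}_A,f^{uv}(a))$ for all $W\xrightarrow{v}V\xrightarrow{u}U$ and $a\in\mathcal A(U)(A,B)$; 4. $\mathrm{MC}(\alpha)_{3,0}=0$ if and only if $m^T(c^{v,w}_{u^*A},c^{u,vw}_A)=m^T(f^w(c^{u,v}_A),c^{uv,w}_A)$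 for all $T\xrightarrow{w}W\xrightarrow{v}V\xrightarrow{u}U$ and objects $A$ of $\mathcal A(U)$. Consequently $\alpha$ is Maurer–Cartan if and only if $(\mathcal A,m,f,c)$ is a lax prestack, that is, a lax functor from $\mathcal U$ to $k$-linear categories given by compositions $m$, restriction functors $f$ and twists $c$ satisfying the conditions in 1–4. Here, as identities are not part of the data $(m,f,c)$, categories are not required to have identity arrows, and no identity conditions are imposed on $f$ and $c$. -/

import Mathlib

open CategoryTheory

namespace BoxOperad

universe v u w w' x

/-! ## Quivers on a small category, simplices and coarsenings -/

/-- A `k`-quiver on a category `C`: a quiver of `k`-modules for every object `U` of `C`, and a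
function `u^*` on objects for every arrow `u : V ⟶ U`, with no further structure or axiom. -/
structure KQuiver (k : Type x) [CommRing k] (C : Type u) [Category.{v} C] where
  /-- the objects of the quiver sitting at `U` -/
  Ob : C → Type w
  /-- the `k`-module of arrows between two objects of the quiver sitting at `U` -/
  Hom : ∀ U : C, Ob U → Ob U → Type w'
  [addCommGroup : ∀ (U : C) (A B : Ob U), AddCommGroup (Hom U A B)]
  [module : ∀ (U : C) (A B : Ob U), Module k (Hom U A B)]
  /-- the function `u^*` on objects -/
  pull : ∀ {V U : C}, (V ⟶ U) → Ob U → Ob V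

attribute [instance] KQuiver.addCommGroup KQuiver.module

/-- `Simplex C p V U` is the set of `p`-simplices `V = U₀ ⟶ U₁ ⟶ ⋯ ⟶ U_p = U` of the nerve
of `C`. -/
inductive Simplex (C : Type u) [Category.{v} C] : ℕ → C → C → Type (max u v)
  | nil (U : C) : Simplex C 0 U U
  | cons {p : ℕ} {V W U : C} (u : V ⟶ W) (σ : Simplex C p W U) : Simplex C (p + 1) V U

/-- `Coarse r p` is the set of strictly increasing maps `f : {0,…,r} → {0,…,p}` with `f 0 = 0`
and `f r = p`.  Such an `f` is built up from the unique map for `r = p = 0`: `keep f` is the map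
`0 ↦ 0, i + 1 ↦ f i + 1` (so that it takes the value `1`), and `merge f` is the map
`0 ↦ 0, i ↦ f i + 1` for `i > 0` (so that it omits the value `1`). -/
inductive Coarse : ℕ → ℕ → Type
  | nil : Coarse 0 0
  | keep {r p : ℕ} (f : Coarse r p) : Coarse (r + 1) (p + 1)
  | merge {r p : ℕ} (f : Coarse (r + 1) p) : Coarse (r + 1) (p + 1)
  deriving DecidableEq

namespace Coarse

/-- All the elements of `Coarse r p`, each listed once. -/
def all : (r p : ℕ) → List (Coarse r p)
  | 0, 0 => [nil]
  | 0, _ + 1 => []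
  | _ + 1, 0 => []
  | r + 1, p + 1 => (all r p).map keep ++ (all (r + 1) p).map merge

/-- The composite map `f ∘ g`. -/
def comp : {t r p : ℕ} → Coarse r p → Coarse t r → Coarse t p
  | _, _, _, nil, nil => nil
  | _, _, _, keep f, keep g => keep (comp f g)
  | _, _, _, keep f, merge g => merge (comp f g)
  | _, _, _, merge f, keep g => merge (comp f (keep g))
  | _, _, _, merge f, merge g => merge (comp f (merge g))

/-- The concatenation of `g : [r] → [p]` and `h : [r'] → [p']`: the map `f : [r' + r] → [p' + p]`
with `f i = g i` for `i ≤ r` and `f (r + i) = p + h i`.  The maps `f` of this form are those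
with `f r = p`. -/
def append : {r p r' p' : ℕ} → Coarse r p → Coarse r' p' → Coarse (r' + r) (p' + p)
  | _, _, _, _, nil, h => h
  | _, _, _, _, keep g, h => keep (append g h)
  | r + 1, _, r', _, merge g, h => merge (r := r' + r) (append (r := r + 1) (r' := r') g h)

end Coarse

namespace Simplex

variable {C : Type u} [Category.{v} C]

/-- Precompose the first arrow of a simplex with `u`. -/
def precomp {V W : C} (u : V ⟶ W) :
    {p : ℕ} → {U : C} → Simplex C (p + 1) W U → Simplex C (p + 1) V U
  | _, _, cons u' σ => cons (u ≫ u') σ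

/-- The simplex `f(σ)`, whose vertices are the vertices of `σ` numbered `f 0, …, f r`. -/
def coarsen : {r p : ℕ} → {V U : C} → Coarse r p → Simplex C p V U → Simplex C r V U
  | _, _, _, _, .nil, σ => σ
  | _, _, _, _, .keep f, cons u σ => cons u (coarsen f σ)
  | _, _, _, _, .merge f, cons u σ => precomp u (coarsen f σ)

/-- Concatenation of simplices. -/
def append {p' : ℕ} {U : C} :
    {p : ℕ} → {V W : C} → Simplex C p V W → Simplex C p' W U → Simplex C (p' + p) V U
  | _, _, _, nil _, τ => τ
  | _, _, _, cons u σ, τ => cons u (append σ τ)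

/-- The `p`-th vertex of a simplex. -/
def mid {p' : ℕ} {U : C} : (p : ℕ) → {V : C} → Simplex C (p' + p) V U → C
  | 0, V, _ => V
  | p + 1, _, cons _ σ => mid p σ

/-- The first `p` arrows of a simplex. -/
def take {p' : ℕ} {U : C} :
    (p : ℕ) → {V : C} → (σ : Simplex C (p' + p) V U) → Simplex C p V (mid p σ)
  | 0, V, _ => nil V
  | p + 1, _, cons u σ => cons u (take p σ)

/-- The arrows of a simplex after the first `p` ones. -/
def drop {p' : ℕ} {U : C} :
    (p : ℕ) → {V : C} → (σ : Simplex C (p' + p) V U) → Simplex C p' (mid p σ) U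
  | 0, _, σ => σ
  | p + 1, _, cons _ σ => drop p σ

lemma append_take_drop {p' : ℕ} {U : C} :
    (p : ℕ) → {V : C} → (σ : Simplex C (p' + p) V U) → append (take p σ) (drop p σ) = σ
  | 0, _, _ => rfl
  | p + 1, _, cons u σ => congrArg (cons u) (append_take_drop p σ)

lemma precomp_append {p' : ℕ} {U : C} {p : ℕ} {V V' W : C} (u : V' ⟶ V)
    (σ : Simplex C (p + 1) V W) (τ : Simplex C p' W U) :
    append (precomp u σ) τ = precomp (p := p' + p) u (append (p := p + 1) (p' := p') σ τ) := by
  cases σ; rfl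

lemma coarsen_append {r p r' p' : ℕ} (g : Coarse r p) (h : Coarse r' p') {V W U : C}
    (σ : Simplex C p V W) (τ : Simplex C p' W U) :
    coarsen (g.append h) (append σ τ) = append (coarsen g σ) (coarsen h τ) := by
  induction g generalizing V with
  | nil => cases σ; rfl
  | keep g ih => cases σ with | cons u σ => exact congrArg (cons u) (ih σ)
  | merge g ih =>
    cases σ with
    | cons u σ => exact (congrArg (precomp u) (ih σ)).trans (precomp_append u (coarsen g σ) _).symm

lemma coarsen_comp {t r p : ℕ} (f : Coarse r p) (g : Coarse t r) {V U : C}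
    (σ : Simplex C p V U) : coarsen (f.comp g) σ = coarsen g (coarsen f σ) := by
  induction f generalizing t V with
  | nil => cases g; rfl
  | keep f ih =>
    cases σ with
    | cons u σ =>
      cases g with
      | keep g => exact congrArg (cons u) (ih g σ)
      | merge g => exact congrArg (precomp u) (ih g σ)
  | merge f ih =>
    cases σ with
    | cons u σ =>
      cases g with
      | keep g =>
        refine (congrArg (precomp u) (ih (.keep g) σ)).trans ?_
        simp only [coarsen]
        generalize coarsen f σ = τ
        cases τ; rfl
      | merge g =>
        refine (congrArg (precomp u) (ih (.merge g) σ)).trans ?_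
        simp only [coarsen]
        generalize coarsen f σ = τ
        cases τ with
        | cons u' τ =>
          simp only [precomp, coarsen]
          generalize coarsen g τ = ρ
          cases ρ
          simp

end Simplex

lemma Coarse.le {r p : ℕ} (f : Coarse r p) : r ≤ p := by
  induction f <;> omega

lemma Simplex.coarsen_self {C : Type u} [Category.{v} C] {p : ℕ} (f : Coarse p p) {V U : C}
    (σ : Simplex C p V U) : σ.coarsen f = σ := by
  induction p generalizing V with
  | zero => cases f; rfl
  | succ p ih =>
    cases f with
    | keep f => cases σ with | cons u σ => exact congrArg (cons u) (ih f σ)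
    | merge f => exact absurd f.le (by omega)

section Cochains

variable {k : Type x} [CommRing k] {C : Type u} [Category.{v} C]

/-- The function `σ^* = u₁^* ∘ ⋯ ∘ u_p^*` on objects. -/
def KQuiver.star (Q : KQuiver.{v, u, w, w', x} k C) :
    {p : ℕ} → {V U : C} → Simplex C p V U → Q.Ob U → Q.Ob V
  | _, _, _, .nil _, A => A
  | _, _, _, .cons u σ, A => Q.pull u (Q.star σ A)

lemma KQuiver.star_append (Q : KQuiver.{v, u, w, w', x} k C) {p p' : ℕ} {V W U : C}
    (σ : Simplex C p V W) (τ : Simplex C p' W U) (A : Q.Ob U) :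
    Q.star (σ.append τ) A = Q.star σ (Q.star τ A) := by
  induction σ with
  | nil => rfl
  | cons u σ ih => exact congrArg (Q.pull u) (ih τ)

lemma KQuiver.star_take_drop (Q : KQuiver.{v, u, w, w', x} k C) {p p' : ℕ} {V U : C}
    (σ : Simplex C (p' + p) V U) (A : Q.Ob U) :
    Q.star (σ.take p) (Q.star (σ.drop p) A) = Q.star σ A := by
  rw [← Q.star_append, σ.append_take_drop]

lemma KQuiver.star_coarsen_take_drop (Q : KQuiver.{v, u, w, w', x} k C) {r p r' p' : ℕ}
    {V U : C} (σ : Simplex C (p' + p) V U) (g : Coarse r p) (h : Coarse r' p')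
    {f : Coarse (r' + r) (p' + p)} (e : g.append h = f) (A : Q.Ob U) :
    Q.star ((σ.take p).coarsen g) (Q.star ((σ.drop p).coarsen h) A) = Q.star (σ.coarsen f) A := by
  rw [← Q.star_append, ← Simplex.coarsen_append, σ.append_take_drop, e]

lemma KQuiver.star_coarsen_comp (Q : KQuiver.{v, u, w, w', x} k C) {t r p : ℕ}
    {V U : C} (σ : Simplex C p V U) {f₁ : Coarse r p} {f₂ : Coarse t r}
    {f : Coarse t p} (e : f₁.comp f₂ = f) (A : Q.Ob U) :
    Q.star ((σ.coarsen f₁).coarsen f₂) A = Q.star (σ.coarsen f) A := by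
  rw [← e, σ.coarsen_comp]

/-- Transport of an arrow along equalities of its end points, as a `k`-linear map. -/
def KQuiver.castHom (Q : KQuiver.{v, u, w, w', x} k C) {U : C} {A A' B B' : Q.Ob U}
    (hA : A = A') (hB : B = B') : Q.Hom U A B →ₗ[k] Q.Hom U A' B' := by
  subst hA hB; exact LinearMap.id

/-- `ArrowPath Q U q A B` is the set of sequences of `q` composable arrows
`A = A₀ ⟶ A₁ ⟶ ⋯ ⟶ A_q = B` of the quiver at `U`. -/
inductive ArrowPath (Q : KQuiver.{v, u, w, w', x} k C) (U : C) : ℕ → Q.Ob U → Q.Ob U → Type (max w w')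
  | nil (A : Q.Ob U) : ArrowPath Q U 0 A A
  | cons {q : ℕ} {A X B : Q.Ob U} (a : Q.Hom U A X) (P : ArrowPath Q U q X B) :
      ArrowPath Q U (q + 1) A B

namespace ArrowPath

variable {Q : KQuiver.{v, u, w, w', x} k C} {U : C}

/-- The `q`-th vertex of a path. -/
def mid {q' : ℕ} {B : Q.Ob U} : (q : ℕ) → {A : Q.Ob U} → ArrowPath Q U (q' + q) A B → Q.Ob U
  | 0, A, _ => A
  | q + 1, _, cons _ P => mid q P

/-- The first `q` arrows of a path. -/
def take {q' : ℕ} {B : Q.Ob U} :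
    (q : ℕ) → {A : Q.Ob U} → (P : ArrowPath Q U (q' + q) A B) → ArrowPath Q U q A (mid q P)
  | 0, A, _ => nil A
  | q + 1, _, cons a P => cons a (take q P)

/-- The arrows of a path after the first `q` ones. -/
def drop {q' : ℕ} {B : Q.Ob U} :
    (q : ℕ) → {A : Q.Ob U} → (P : ArrowPath Q U (q' + q) A B) → ArrowPath Q U q' (mid q P) B
  | 0, _, P => P
  | q + 1, _, cons _ P => drop q P

/-- Transport of a path along an equality of its last vertices. -/
def castEnd {q : ℕ} {A B B' : Q.Ob U} (h : B = B') (P : ArrowPath Q U q A B) : ArrowPath Q U q A B' :=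
  h ▸ P

/-- `φ`, defined on the paths of length `q` that start at `A`, is `k`-linear in each of the `q`
arrows of the path separately; equivalently, it is given by linear maps on the tensor products
`Hom(A₀,A₁) ⊗ ⋯ ⊗ Hom(A_{q-1},A_q)` with `A₀ = A`. -/
def IsMultilinear {M : Q.Ob U → Type w'} [∀ B, AddCommGroup (M B)] [∀ B, Module k (M B)] :
    {q : ℕ} → {A : Q.Ob U} → (∀ B, ArrowPath Q U q A B → M B) → Prop
  | 0, _, _ => True
  | _ + 1, A, φ => ∀ X : Q.Ob U,
      (∀ B P, IsLinearMap k fun a : Q.Hom U A X => φ B (cons a P)) ∧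
        ∀ a : Q.Hom U A X, IsMultilinear fun B P => φ B (cons a P)

variable {M N : Q.Ob U → Type w'} [∀ B, AddCommGroup (M B)] [∀ B, Module k (M B)]
  [∀ B, AddCommGroup (N B)] [∀ B, Module k (N B)]

lemma IsMultilinear.zero {q : ℕ} {A : Q.Ob U} :
    IsMultilinear (M := M) (q := q) (A := A) fun _ _ => 0 := by
  induction q generalizing A with
  | zero => trivial
  | succ q ih => exact fun X => ⟨fun B P => ⟨by simp, by simp⟩, fun a => ih⟩

lemma IsMultilinear.add {q : ℕ} {A : Q.Ob U} {φ ψ : ∀ B, ArrowPath Q U q A B → M B}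
    (hφ : IsMultilinear φ) (hψ : IsMultilinear ψ) :
    IsMultilinear fun B P => φ B P + ψ B P := by
  induction q generalizing A with
  | zero => trivial
  | succ q ih =>
    exact fun X => ⟨fun B P => ((hφ X).1 B P).mk' _ + ((hψ X).1 B P).mk' _ |>.isLinear,
      fun a => ih ((hφ X).2 a) ((hψ X).2 a)⟩

lemma IsMultilinear.map {q : ℕ} {A : Q.Ob U} {φ : ∀ B, ArrowPath Q U q A B → M B}
    (hφ : IsMultilinear φ) (L : ∀ B, M B →ₗ[k] N B) :
    IsMultilinear fun B P => L B (φ B P) := by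
  induction q generalizing A with
  | zero => trivial
  | succ q ih =>
    exact fun X => ⟨fun B P => ((L B).comp (((hφ X).1 B P).mk' _)).isLinear,
      fun a => ih ((hφ X).2 a)⟩

lemma IsMultilinear.listSum {ι : Type*} (l : List ι) {q : ℕ} {A : Q.Ob U}
    {φ : ι → ∀ B, ArrowPath Q U q A B → M B} (hφ : ∀ i, IsMultilinear (φ i)) :
    IsMultilinear fun B P => (l.map fun i => φ i B P).sum := by
  induction l with
  | nil => simpa using IsMultilinear.zero
  | cons i l ih => simpa using (hφ i).add ih


/-- A map that factors as `P ↦ Ψ (φ (take q P)) (drop q P)` through multilinear maps is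
multilinear. -/
lemma IsMultilinear.split {q q' : ℕ} {A : Q.Ob U} {φ : ∀ X, ArrowPath Q U q A X → N X}
    (hφ : IsMultilinear φ) (Ψ : ∀ X, N X → ∀ B, ArrowPath Q U q' X B → M B)
    (hlin : ∀ X B P, IsLinearMap k fun t : N X => Ψ X t B P)
    (hΨ : ∀ X t, IsMultilinear (Ψ X t)) :
    IsMultilinear (q := q' + q) fun B P => Ψ _ (φ _ (take q P)) B (drop q P) := by
  induction q generalizing A with
  | zero => exact hΨ A (φ A (nil A))
  | succ q ih =>
    exact fun X => ⟨fun B P => (((hlin _ B _).mk' _).comp (((hφ X).1 _ _).mk' _)).isLinear,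
      fun a => ih ((hφ X).2 a)⟩

end ArrowPath

/-! ## The Gerstenhaber–Schack box operad of a quiver -/

variable (Q : KQuiver.{v, u, w, w', x} k C)

/-- Families of functions `A(U)(A₀,A₁) × ⋯ × A(U)(A_{q-1},A_q) → A(V)(σ^* A₀, f(σ)^* A_q)`, one
for each `p`-simplex `σ` from `V` to `U`, each strictly increasing `f : [r] → [p]` preserving the
end points, and all objects `A₀, …, A_q`. -/
abbrev RawCochain (p q r : ℕ) : Type (max v u w w') :=
  ∀ (V U : C) (σ : Simplex C p V U) (f : Coarse r p) (A B : Q.Ob U),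
    ArrowPath Q U q A B → Q.Hom V (Q.star σ A) (Q.star (σ.coarsen f) B)

/-- The `k`-module
`∏_{σ, f} ∏_{A₀,…,A_q} Hom_k(⨂ᵢ A(U)(A_{i-1},A_i), A(V)(σ^* A₀, f(σ)^* A_q))`.
It is zero for `p < r`, since then there is no `f`. -/
def Cochain (p q r : ℕ) : Submodule k (RawCochain Q p q r) where
  carrier := {φ | ∀ V U σ f A,
    ArrowPath.IsMultilinear fun (B : Q.Ob U) P => φ V U σ f A B P}
  add_mem' hφ hψ := fun V U σ f A => (hφ V U σ f A).add (hψ V U σ f A)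
  zero_mem' := fun _ _ _ _ _ => .zero
  smul_mem' c _ hφ := fun V U σ f A => (hφ V U σ f A).map fun _ => c • LinearMap.id

variable {Q}

/-- The identity cochain of size `(0,1,0)`. -/
def RawCochain.one : RawCochain Q 0 1 0
  | _, _, .nil _, .nil, _, _, .cons a (.nil _) => a

variable (Q) in
/-- The shape of a tensor product over the quiver of `n` cochains of sizes
`(p₀,q₁,p₁), …, (p_{n-1},q_n,p_n)` with `q = q₁ + ⋯ + q_n`: for `σ`, `f` and a path of length
`q` at the end `U` of `σ` a sum of elementary tensors of `n` composable arrows at `V`, which is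
recorded as the list of its terms. -/
abbrev Tensor (n p₀ q pₙ : ℕ) : Type (max v u w w') :=
  ∀ (V U : C) (σ : Simplex C p₀ V U) (f : Coarse pₙ p₀) (A B : Q.Ob U),
    ArrowPath Q U q A B → List (ArrowPath Q V n (Q.star σ A) (Q.star (σ.coarsen f) B))

/-- The empty tensor product. -/
def Tensor.nil (p : ℕ) : Tensor Q 0 p 0 p
  | _, _, σ, f, A, _, .nil _ => [(ArrowPath.nil (Q.star σ A)).castEnd (by rw [σ.coarsen_self f])]

/-- The tensor product of `θ` and `Θ`:
`(θ ⊗ Θ)^{σ,f} = ∑_{f = f₁ ∘ f₂} θ^{σ,f₁} ⊗ Θ^{f₁(σ),f₂}`, where `θ` takes the first `q` arrows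
and `Θ` the other ones. -/
def Tensor.cons {n p₀ q p₁ q' pₙ : ℕ} (θ : RawCochain Q p₀ q p₁) (Θ : Tensor Q n p₁ q' pₙ) :
    Tensor Q (n + 1) p₀ (q' + q) pₙ := fun V U σ f A B P =>
  (Coarse.all p₁ p₀).flatMap fun f₁ => (Coarse.all pₙ p₁).flatMap fun f₂ =>
    if h : f₁.comp f₂ = f then
      (Θ V U (σ.coarsen f₁) f₂ _ B (P.drop q)).map fun T =>
        (ArrowPath.cons (θ V U σ f₁ A _ (P.take q)) T).castEnd
          (Q.star_coarsen_comp σ h B)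
    else []

/-- The composition of `θ` with a tensor product `Θ` of `n` cochains:
`(θ ∘ Θ)^{σ,f} = θ^{σ₁,g} ∘ Θ^{σ₂,h}` if `f` is the concatenation of `g` and `h`, where `σ₁`
consists of the first `p` arrows of `σ` and `σ₂` of the other ones; and `(θ ∘ Θ)^{σ,f} = 0` if
`f r ≠ p`. -/
def RawCochain.comp {p n r p₀ q pₙ : ℕ} (θ : RawCochain Q p n r) (Θ : Tensor Q n p₀ q pₙ) :
    RawCochain Q (p₀ + p) q (pₙ + r) := fun V U σ f A B P =>
  ((Coarse.all r p).map fun g => ((Coarse.all pₙ p₀).map fun h =>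
    if e : g.append h = f then
      ((Θ _ U (σ.drop p) h A B P).map fun T =>
        Q.castHom (Q.star_take_drop σ A) (Q.star_coarsen_take_drop σ g h e B)
          (θ V _ (σ.take p) g _ _ T)).sum
    else 0).sum).sum

/-- `Θ` is multilinear as a map to the tensor product. -/
def Tensor.IsMultilinear {n p₀ q pₙ : ℕ} (Θ : Tensor Q n p₀ q pₙ) : Prop :=
  ∀ (V U : C) (σ : Simplex C p₀ V U) (f : Coarse pₙ p₀) (A : Q.Ob U) (M : Q.Ob V → Type w')
    [∀ Y, AddCommGroup (M Y)] [∀ Y, Module k (M Y)]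
    (K : ∀ Y, ArrowPath Q V n (Q.star σ A) Y → M Y), ArrowPath.IsMultilinear K →
    ArrowPath.IsMultilinear fun (B : Q.Ob U) P => ((Θ V U σ f A B P).map (K _)).sum

lemma Tensor.isMultilinear_nil (p : ℕ) : (Tensor.nil p : Tensor Q 0 p 0 p).IsMultilinear :=
  fun _ _ _ _ _ _ _ _ _ _ => trivial

lemma ArrowPath.exists_castEnd {V : C} {Y Y' : Q.Ob V} (h : Y = Y') (M : Q.Ob V → Type w')
    [∀ Y, AddCommGroup (M Y)] [∀ Y, Module k (M Y)] :
    ∃ L : M Y →ₗ[k] M Y', ∀ (n : ℕ) (X : Q.Ob V) (K : ∀ Y, ArrowPath Q V n X Y → M Y)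
      (T : ArrowPath Q V n X Y), K Y' (T.castEnd h) = L (K Y T) := by
  subst h; exact ⟨LinearMap.id, fun _ _ _ _ => rfl⟩

lemma listSum_flatMap {ι M : Type*} [AddCommMonoid M] (l : List ι) (F : ι → List M) :
    (l.flatMap F).sum = (l.map fun i => (F i).sum).sum := by
  induction l <;> simp_all

lemma Tensor.IsMultilinear.cons {n p₀ q p₁ q' pₙ : ℕ} {θ : RawCochain Q p₀ q p₁}
    (hθ : θ ∈ Cochain Q p₀ q p₁) {Θ : Tensor Q n p₁ q' pₙ} (hΘ : Θ.IsMultilinear) :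
    (Tensor.cons θ Θ).IsMultilinear := by
  intro V U σ f A M _ _ K hK
  choose L hL using fun (f₁ : Coarse p₁ p₀) (f₂ : Coarse pₙ p₁) (h : f₁.comp f₂ = f) (B : Q.Ob U) =>
    ArrowPath.exists_castEnd (Q.star_coarsen_comp σ h B) M
  have key : ∀ (B : Q.Ob U) (P : ArrowPath Q U (q' + q) A B),
      ((Tensor.cons θ Θ V U σ f A B P).map (K _)).sum =
        ((Coarse.all p₁ p₀).map fun f₁ => ((Coarse.all pₙ p₁).map fun f₂ =>
          if h : f₁.comp f₂ = f then
            L f₁ f₂ h B (((Θ V U (σ.coarsen f₁) f₂ _ B (P.drop q)).map fun T =>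
                K _ (.cons (θ V U σ f₁ A _ (P.take q)) T)).sum)
          else (0 : M (Q.star (σ.coarsen f) B))).sum).sum := by
    intro B P
    simp only [Tensor.cons, List.map_flatMap, listSum_flatMap]
    congr 2; funext f₁; congr 2; funext f₂
    split_ifs with h
    · simp only [map_list_sum, List.map_map]
      congr 2; funext T
      exact hL f₁ f₂ h B _ _ K _
    · simp
  simp only [key]
  refine .listSum _ fun f₁ => .listSum _ fun f₂ => ?_
  by_cases h : f₁.comp f₂ = f
  · simp only [h, dite_true]
    refine ArrowPath.IsMultilinear.map
      (M := fun B => M (Q.star ((σ.coarsen f₁).coarsen f₂) B)) ?_ fun B => L f₁ f₂ h B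
    refine ArrowPath.IsMultilinear.split (hθ V U σ f₁ A)
      (fun Z t B P => ((Θ V U (σ.coarsen f₁) f₂ Z B P).map fun T => K _ (.cons t T)).sum) ?_ ?_
    · intro Z B P
      induction Θ V U (σ.coarsen f₁) f₂ Z B P with
      | nil => exact ⟨by simp, by simp⟩
      | cons T l ih =>
        simp only [List.map_cons, List.sum_cons]
        exact (((hK _).1 _ T).mk' _ + ih.mk' _).isLinear
    · exact fun Z t => hΘ V U _ f₂ Z M _ ((hK _).2 t)
  · simp only [h, dite_false]
    exact .zero

lemma RawCochain.comp_mem {p n r p₀ q pₙ : ℕ} {θ : RawCochain Q p n r}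
    (hθ : θ ∈ Cochain Q p n r) {Θ : Tensor Q n p₀ q pₙ} (hΘ : Θ.IsMultilinear) :
    θ.comp Θ ∈ Cochain Q (p₀ + p) q (pₙ + r) := by
  intro V U σ f A
  refine .listSum _ fun g => .listSum _ fun h => ?_
  by_cases e : g.append h = f
  · simp only [e, dite_true]
    have := (hΘ _ U (σ.drop p) h A _ _ (hθ V _ (σ.take p) g (Q.star (σ.drop p) A))).map
      (N := fun B => Q.Hom V (Q.star σ A) (Q.star (σ.coarsen f) B)) fun B =>
        Q.castHom (Q.star_take_drop σ A) (Q.star_coarsen_take_drop σ g h e B)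
    simpa only [map_list_sum, List.map_map, Function.comp_def] using this
  · simp only [e, dite_false]
    exact .zero

lemma RawCochain.one_mem : (RawCochain.one : RawCochain Q 0 1 0) ∈ Cochain Q 0 1 0 := by
  intro V U σ f A
  cases σ; cases f
  refine fun X => ⟨fun B P => ?_, fun _ => trivial⟩
  cases P
  exact LinearMap.id.isLinear

end Cochains

/-! ## Stackings of boxes -/

mutual

/-- Admissible stackings of boxes in standard order, including formal units, by the size
`(p,q,r)` of the resulting box.  A stacking is the unit `η` of size `(0,1,0)`, or it consists of
a bottom box of size `(p,n,r)` with a row of `n` stackings on top of its `n` inputs.  So an input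
of a box carries either the root of another stacking or a unit, i.e. it is an input of the whole;
a box with `n = 0` carries an empty row, whose start value is `p₀ = pₙ`.  The boxes are numbered
in standard order: first the bottom box, then the boxes of the row from left to right. -/
inductive Stacking : ℕ → ℕ → ℕ → Type
  | unit : Stacking 0 1 0
  | box (p r : ℕ) {n p₀ q pₙ : ℕ} (F : Row n p₀ q pₙ) : Stacking (p₀ + p) q (pₙ + r)

/-- `Row n p₀ q pₙ`: rows of `n` stackings of sizes `(p₀,q₁,p₁), …, (p_{n-1},q_n,p_n)`, with
`q = q₁ + ⋯ + q_n`. -/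
inductive Row : ℕ → ℕ → ℕ → ℕ → Type
  | nil (p : ℕ) : Row 0 p 0 p
  | cons {n p₀ q p₁ q' pₙ : ℕ} (S : Stacking p₀ q p₁) (F : Row n p₁ q' pₙ) :
      Row (n + 1) p₀ (q' + q) pₙ

end

mutual

/-- The sizes of the boxes, in standard order. -/
def Stacking.boxes : {p q r : ℕ} → Stacking p q r → List (ℕ × ℕ × ℕ)
  | _, _, _, .unit => []
  | _, _, _, .box (n := n) p r F => (p, n, r) :: F.boxes

/-- The sizes of the boxes, row by row from left to right. -/
def Row.boxes : {n p₀ q pₙ : ℕ} → Row n p₀ q pₙ → List (ℕ × ℕ × ℕ)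
  | _, _, _, _, .nil _ => []
  | _, _, _, _, .cons S F => S.boxes ++ F.boxes

end

/-- The number of boxes. -/
def Stacking.size {p q r : ℕ} (S : Stacking p q r) : ℕ := S.boxes.length

/-! ### The horizontal composite graph -/

/-- The left end of a wire of the horizontal composite graph: `inl j` is the `j`-th input of the
whole graph, `inr i` is an output of box `i`. -/
abbrev Wire := ℕ ⊕ ℕ

mutual

/-- Given the left ends of the wires that enter a stacking from the left (from bottom to top),
the left ends of the wires that leave it on the right.  The boxes are numbered from `i` on. -/
def Stacking.wires : {p q r : ℕ} → Stacking p q r → (i : ℕ) → List Wire → List Wire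
  | _, _, _, .unit, _, l => l
  | _, _, _, .box p r F, i, l => List.replicate r (.inr i) ++ F.wires (i + 1) (l.drop p)

/-- The same for a row: the outputs of each stacking are the inputs of the next one. -/
def Row.wires : {n p₀ q pₙ : ℕ} → Row n p₀ q pₙ → (i : ℕ) → List Wire → List Wire
  | _, _, _, _, .nil _, _, l => l
  | _, _, _, _, .cons S F, i, l => F.wires (i + S.size) (S.wires i l)

end

mutual

/-- The wires of the horizontal composite graph that end in an input of a box: the pairs of the
left end of such a wire and the number of the box in which it ends. -/
def Stacking.links : {p q r : ℕ} → Stacking p q r → (i : ℕ) → List Wire → List (Wire × ℕ)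
  | _, _, _, .unit, _, _ => []
  | _, _, _, .box p _ F, i, l => (l.take p).map (·, i) ++ F.links (i + 1) (l.drop p)

/-- The same for a row. -/
def Row.links : {n p₀ q pₙ : ℕ} → Row n p₀ q pₙ → (i : ℕ) → List Wire → List (Wire × ℕ)
  | _, _, _, _, .nil _, _, _ => []
  | _, _, _, _, .cons S F, i, l => S.links i l ++ F.links (i + S.size) (S.wires i l)

end

/-- The vertices of the horizontal composite graph as drawn in the plane: its inputs and its
boxes.  An input that is not connected to a box belongs to a wire that runs straight through to
an output, and such a wire is a connected component of its own. -/
abbrev Stacking.Vertex {p q r : ℕ} (S : Stacking p q r) : Type := Fin p ⊕ Fin S.size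

/-- A wire leads from the vertex `a` to the box `b`. -/
def Stacking.Adjacent {p q r : ℕ} (S : Stacking p q r) (a b : S.Vertex) : Prop :=
  ∃ j, b = .inr j ∧
    (Sum.map Fin.val Fin.val a, j.val) ∈ S.links 0 ((List.range p).map Sum.inl)

/-- The number of connected components of the horizontal composite graph. -/
noncomputable def Stacking.numComponents {p q r : ℕ} (S : Stacking p q r) : ℕ :=
  Nat.card (Quot S.Adjacent)

/-! ### Degrees and signs -/

/-- A box of size `(p,q,r)` is thin if `p = r = 0`. -/
def IsThin (b : ℕ × ℕ × ℕ) : Prop := b.1 = 0 ∧ b.2.2 = 0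

instance : DecidablePred IsThin := fun _ => inferInstanceAs (Decidable (_ ∧ _))

/-- A box of size `(p,q,r)` is semi-thin if exactly one of `p` and `r` is zero. -/
def IsSemiThin (b : ℕ × ℕ × ℕ) : Prop := ¬ IsThin b ∧ (b.1 = 0 ∨ b.2.2 = 0)

/-- The thin desuspended degree of a box of size `(p,q,r)`: `q - 1` if the box is thin, and
`p - r + q` otherwise. -/
def tdDegree (b : ℕ × ℕ × ℕ) : ℤ :=
  if IsThin b then (b.2.1 : ℤ) - 1 else (b.1 : ℤ) - b.2.2 + b.2.1

/-- The sum `∑ᵢ (qᵢ - 1)(n - i) + ∑ᵢ (qᵢ - 1)(c - p_{i-1})` over a row of `n` stackings. -/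
def Row.shuffleSign (c : ℤ) : {n p₀ q pₙ : ℕ} → Row n p₀ q pₙ → ℤ
  | _, _, _, _, .nil _ => 0
  | _, _, _, _, .cons (n := n) (p₀ := p₀) (q := q) _ F =>
      ((q : ℤ) - 1) * n + ((q : ℤ) - 1) * (c - p₀) + F.shuffleSign c

mutual

/-- The exponent of the desuspended sign.  It is additive under composition of stackings in
standard order, and for a box of size `(p,n,r)` with a row of `n` stackings on top it has the
contribution
`(p₀ + pₙ) r + ∑ᵢ (qᵢ - 1)(n - i) + ∑ᵢ (qᵢ - 1)(p - r + p₀ - p_{i-1})`. -/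
def Stacking.dSign : {p q r : ℕ} → Stacking p q r → ℤ
  | _, _, _, .unit => 0
  | _, _, _, .box (p₀ := p₀) (pₙ := pₙ) p r F =>
      ((p₀ : ℤ) + pₙ) * r + F.shuffleSign ((p : ℤ) - r + p₀) + F.dSign

/-- The same for a row. -/
def Row.dSign : {n p₀ q pₙ : ℕ} → Row n p₀ q pₙ → ℤ
  | _, _, _, _, .nil _ => 0
  | _, _, _, _, .cons S F => S.dSign + F.dSign

end

/-- The sum, over the boxes, of the degree of the box times the number of later non-thin boxes. -/
def nonThinSum : List (ℕ × ℕ × ℕ) → ℤ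
  | [] => 0
  | b :: l => tdDegree b * l.countP (fun b' => ¬ IsThin b') + nonThinSum l

/-- The sum, over the boxes, of the degree of the box times the degrees of all later boxes. -/
def pairSum : List (ℕ × ℕ × ℕ) → ℤ
  | [] => 0
  | b :: l => tdDegree b * (l.map tdDegree).sum + pairSum l

namespace Stacking

variable {p q r : ℕ} (S : Stacking p q r)

/-- The exponent of the thin desuspended sign `(-1)^{S^td}`. -/
def tdSign : ℤ := S.dSign + S.size + nonThinSum S.boxes

/-- The thin desuspended degree `|S^td|` of a stacking. -/
def degree : ℤ := tdDegree (p, q, r) - (S.boxes.map tdDegree).sum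

/-- The exponent of the sign in
`S^td(θ₁^td,…,θₙ^td) = ± S(θ₁,…,θₙ)^td` for `θᵢ` of the size of box `i`:
`|S|(|S| + 1)/2 + |S| td(p,q,r) + ∑_{i<j} |θᵢ| |θⱼ|`. -/
def actionSign : ℤ :=
  S.degree * (S.degree + 1) / 2 + S.degree * tdDegree (p, q, r) + pairSum S.boxes

/-- A stacking of `n` boxes (in standard order) is thin-quadratic if it has degree `2 - n`, its
horizontal composite graph has exactly two connected components, and it has no semi-thin boxes. -/
def IsThinQuadratic : Prop :=
  S.degree = 2 - S.size ∧ S.numComponents = 2 ∧ ∀ b ∈ S.boxes, ¬ IsSemiThin b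

end Stacking

/-! ## The higher Gerstenhaber braces -/

section Brace

variable {k : Type x} [CommRing k] {C : Type u} [Category.{v} C]
  {Q : KQuiver.{v, u, w, w', x} k C}

mutual

/-- The cochain `S(θ₁,…,θₙ)`: box number `i` is filled with the component of `θ i` of the size of
that box, the boxes being numbered from `i₀` on. -/
def Stacking.eval (θ : ℕ → ∀ p q r, RawCochain Q p q r) :
    {p q r : ℕ} → Stacking p q r → (i₀ : ℕ) → RawCochain Q p q r
  | _, _, _, .unit, _ => RawCochain.one
  | _, _, _, .box (n := n) p r F, i₀ => (θ i₀ p n r).comp (F.eval θ (i₀ + 1))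

/-- The tensor product of the cochains of the stackings in a row. -/
def Row.eval (θ : ℕ → ∀ p q r, RawCochain Q p q r) :
    {n p₀ q pₙ : ℕ} → Row n p₀ q pₙ → (i₀ : ℕ) → Tensor Q n p₀ q pₙ
  | _, _, _, _, .nil p, _ => Tensor.nil p
  | _, _, _, _, .cons S F, i₀ => Tensor.cons (S.eval θ i₀) (F.eval θ (i₀ + S.size))

end

mutual

lemma Stacking.eval_mem {θ : ℕ → ∀ p q r, RawCochain Q p q r}
    (hθ : ∀ i p q r, θ i p q r ∈ Cochain Q p q r) :
    {p q r : ℕ} → (S : Stacking p q r) → (i₀ : ℕ) → S.eval θ i₀ ∈ Cochain Q p q r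
  | _, _, _, .unit, _ => RawCochain.one_mem
  | _, _, _, .box p r F, i₀ => RawCochain.comp_mem (hθ i₀ p _ r) (F.eval_isMultilinear hθ _)

lemma Row.eval_isMultilinear {θ : ℕ → ∀ p q r, RawCochain Q p q r}
    (hθ : ∀ i p q r, θ i p q r ∈ Cochain Q p q r) :
    {n p₀ q pₙ : ℕ} → (F : Row n p₀ q pₙ) → (i₀ : ℕ) → (F.eval θ i₀).IsMultilinear
  | _, _, _, _, .nil p, _ => Tensor.isMultilinear_nil p
  | _, _, _, _, .cons S F, i₀ =>
      Tensor.IsMultilinear.cons (S.eval_mem hθ i₀) (F.eval_isMultilinear hθ _)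

end

variable (Q) in
/-- The totalisation of the Gerstenhaber–Schack box operad.  The cochains of size `(p,q,r)` have
degree `tdDegree (p,q,r)`. -/
abbrev Tot : Type (max v u w w') := ∀ p q r : ℕ, Cochain Q p q r

/-- The `n`-th Gerstenhaber brace
`P_n(θ₁,…,θₙ) = ∑_S (-1)^{S^td} S^td(θ₁,…,θₙ)`, where `S` runs over the thin-quadratic
stackings of `n` boxes.  For given size of the result only finitely many `S` have no box with
`p < r`, and the other ones contribute zero, so that the sum is finite. -/
noncomputable def brace (n : ℕ) (θ : Fin n → Tot Q) : Tot Q := fun p q r =>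
  ∑ᶠ S : {S : Stacking p q r // S.size = n ∧ S.IsThinQuadratic},
    (S.1.tdSign + S.1.actionSign).negOnePow •
      (⟨S.1.eval (fun i p q r => if h : i < n then θ ⟨i, h⟩ p q r else 0) 0,
        S.1.eval_mem (fun i p q r => by
          split_ifs
          · exact (θ _ p q r).2
          · exact Submodule.zero_mem _) 0⟩ : Cochain Q p q r)

/-- The Maurer–Cartan expression `∑_{n ≥ 2} (-1)^{n(n+1)/2} P_n(θ,…,θ)`. -/
noncomputable def maurerCartan (θ : Tot Q) : Tot Q :=
  ∑ᶠ (n : ℕ) (_ : 2 ≤ n), (-1 : ℤ) ^ (n * (n + 1) / 2) • brace n fun _ => θ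

/-! ## The Gerstenhaber–Schack object -/

/-- The number `min {1, p}`. -/
def gsRight : ℕ → ℕ
  | 0 => 0
  | _ + 1 => 1

variable (Q) in
/-- The Gerstenhaber–Schack object: its component `C_GS^{p,q}` consists of the cochains of size
`(0,q,0)` for `p = 0`, and of size `(p,q,1)` for `p ≥ 1`. -/
abbrev GSObject : Type (max v u w w') := ∀ p q : ℕ, Cochain Q p q (gsRight p)

variable (Q) in
/-- The elements of degree `n` of the desuspended Gerstenhaber–Schack object:
`⨁_{p + q = n + 1} C_GS^{p,q}`. -/
def gsDegree (n : ℤ) : Submodule k (GSObject Q) where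
  carrier := {α | ∀ p q : ℕ, (p : ℤ) + q - 1 ≠ n → α p q = 0}
  add_mem' hα hβ p q h := by simp [hα p q h, hβ p q h]
  zero_mem' _ _ _ := rfl
  smul_mem' c α hα p q h := by simp [hα p q h]

/-- The inclusion of the Gerstenhaber–Schack object in the totalisation of the
Gerstenhaber–Schack box operad. -/
def GSObject.toTot (α : GSObject Q) : Tot Q
  | 0, q, 0 => α 0 q
  | p + 1, q, 1 => α (p + 1) q
  | _, _, _ => 0

/-- `α` satisfies the Maurer–Cartan equation `∑_{n ≥ 2} (-1)^{n(n+1)/2} P_n(α,…,α) = 0` for the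
braces of the box operad, restricted to the Gerstenhaber–Schack object. -/
def IsMaurerCartan (α : GSObject Q) : Prop := maurerCartan α.toTot = 0

end Brace

/-! ## Lax prestacks -/

section LaxPrestack

variable {k : Type x} [CommRing k] {C : Type u} [Category.{v} C]
  {Q : KQuiver.{v, u, w, w', x} k C}
  (m : Cochain Q 0 2 0) (f : Cochain Q 1 1 1) (c : Cochain Q 2 0 1)

/-- The composition `m^U : A(U)(A,B) ⊗ A(U)(B,D) → A(U)(A,D)`. -/
def mul {U : C} {A B D : Q.Ob U} (a : Q.Hom U A B) (b : Q.Hom U B D) : Q.Hom U A D :=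
  m.1 U U (.nil U) .nil A D (.cons a (.cons b (.nil D)))

/-- The restriction `f^u : A(U)(A,B) → A(V)(u^* A, u^* B)` for `u : V ⟶ U`. -/
def res {V U : C} (u : V ⟶ U) {A B : Q.Ob U} (a : Q.Hom U A B) :
    Q.Hom V (Q.pull u A) (Q.pull u B) :=
  f.1 V U (.cons u (.nil U)) (.keep .nil) A B (.cons a (.nil B))

/-- The twist `c^{u,v}_A : v^* u^* A → (u v)^* A` for `v : W ⟶ V` and `u : V ⟶ U`. -/
def twist {W V U : C} (v : W ⟶ V) (u : V ⟶ U) (A : Q.Ob U) :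
    Q.Hom W (Q.pull v (Q.pull u A)) (Q.pull (v ≫ u) A) :=
  c.1 W U (.cons v (.cons u (.nil U))) (.merge (.keep .nil)) A A (.nil A)

/-- The composition is associative. -/
def IsAssociative : Prop :=
  ∀ (U : C) (A₀ A₁ A₂ A₃ : Q.Ob U) (a : Q.Hom U A₀ A₁) (b : Q.Hom U A₁ A₂) (d : Q.Hom U A₂ A₃),
    mul m (mul m a b) d = mul m a (mul m b d)

/-- The restrictions preserve the composition. -/
def IsFunctorial : Prop :=
  ∀ (V U : C) (u : V ⟶ U) (A₀ A₁ A₂ : Q.Ob U) (a : Q.Hom U A₀ A₁) (b : Q.Hom U A₁ A₂),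
    res f u (mul m a b) = mul m (res f u a) (res f u b)

/-- The twists are natural transformations `v^* u^* → (u v)^*`. -/
def IsNatural : Prop :=
  ∀ (W V U : C) (v : W ⟶ V) (u : V ⟶ U) (A B : Q.Ob U) (a : Q.Hom U A B),
    mul m (res f v (res f u a)) (twist c v u B) = mul m (twist c v u A) (res f (v ≫ u) a)

/-- The twists satisfy the coherence condition
`c^{u,vw} (c^{v,w} ∘ u^*) = c^{uv,w} (w^* ∘ c^{u,v})`. -/
def IsCoherent : Prop :=
  ∀ (T W V U : C) (w : T ⟶ W) (v : W ⟶ V) (u : V ⟶ U) (A : Q.Ob U),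
    Q.castHom rfl (by rw [Category.assoc])
        (mul m (twist c w v (Q.pull u A)) (twist c (w ≫ v) u A)) =
      mul m (res f w (twist c v u A)) (twist c w (v ≫ u) A)

/-- `(m, f, c)` makes the quiver a lax prestack: a lax functor from `C` to `k`-linear categories,
with composition `m`, restriction functors `f` and twists `c`.  Identity arrows are not part of
the structure. -/
structure IsLaxPrestack : Prop where
  assoc : IsAssociative m
  functorial : IsFunctorial m f
  natural : IsNatural m f c
  coherent : IsCoherent m f c

end LaxPrestack

end BoxOperad

namespace BoxOperad

universe v u w w' x

/-! ## Connected components of the horizontal composite graph -/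

lemma join_of_quot_mk_eq {V : Type*} {R : V → V → Prop}
    (hfun : ∀ a b b', R a b → R a b' → b = b') {a b : V} (h : Quot.mk R a = Quot.mk R b) :
    Relation.Join (Relation.ReflTransGen R) a b := by
  have hcr : ∀ a b c, R a b → R a c → ∃ d, Relation.ReflGen R b d ∧ Relation.ReflTransGen R c d := by
    rintro a b c hb hc
    obtain rfl := hfun a b c hb hc
    exact ⟨b, .refl, .refl⟩
  have heq := Relation.equivalence_join_reflTransGen hcr
  induction Quot.eqvGen_exact h with
  | rel a b hab => exact ⟨b, .single hab, .refl⟩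
  | refl a => exact heq.refl a
  | symm a b _ ih => exact heq.symm (ih (Quot.eqvGen_sound ‹_›))
  | trans a b c _ _ ih₁ ih₂ =>
    exact heq.trans (ih₁ (Quot.eqvGen_sound ‹_›)) (ih₂ (Quot.eqvGen_sound ‹_›))

/-- In a graph in which every vertex has at most one outgoing edge, and without infinite paths,
every component contains exactly one vertex without outgoing edge. -/
lemma natCard_quot_of_functional {V : Type*} {R : V → V → Prop} (rank : V → ℕ)
    (hrank : ∀ a b, R a b → rank b < rank a) (hfun : ∀ a b b', R a b → R a b' → b = b') :
    Nat.card (Quot R) = Nat.card {a // ¬ ∃ b, R a b} := by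
  refine (Nat.card_eq_of_bijective (fun a : {a // ¬ ∃ b, R a b} => Quot.mk R a.1) ⟨?_, ?_⟩).symm
  · rintro ⟨a, ha⟩ ⟨b, hb⟩ h
    obtain ⟨c, hac, hbc⟩ := join_of_quot_mk_eq hfun h
    have key : ∀ x, (¬ ∃ b, R x b) → Relation.ReflTransGen R x c → x = c := by
      intro x hx hxc
      rcases Relation.ReflTransGen.cases_head hxc with rfl | ⟨y, hy, -⟩
      · rfl
      · exact absurd ⟨y, hy⟩ hx
    exact Subtype.ext ((key a ha hac).trans (key b hb hbc).symm)
  · intro x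
    induction x using Quot.ind with
    | mk a =>
      induction h : rank a using Nat.strong_induction_on generalizing a with
      | _ n ih =>
        by_cases ha : ∃ b, R a b
        · obtain ⟨b, hb⟩ := ha
          obtain ⟨c, hc⟩ := ih _ (h ▸ hrank a b hb) b rfl
          exact ⟨c, hc.trans (Quot.sound hb).symm⟩
        · exact ⟨⟨a, ha⟩, rfl⟩

/-- The outputs of the boxes in a list, the boxes being numbered from `i` on. -/
def outputs : ℕ → List (ℕ × ℕ × ℕ) → List Wire
  | _, [] => []
  | i, b :: l => List.replicate b.2.2 (.inr i) ++ outputs (i + 1) l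

lemma outputs_append (i : ℕ) (l l' : List (ℕ × ℕ × ℕ)) :
    outputs i (l ++ l') = outputs i l ++ outputs (i + l.length) l' := by
  induction l generalizing i with
  | nil => rfl
  | cons b l ih => simp [outputs, ih, Nat.add_right_comm, Nat.add_assoc]

lemma exists_of_mem_outputs {i : ℕ} {l : List (ℕ × ℕ × ℕ)} {w : Wire} (h : w ∈ outputs i l) :
    ∃ j, w = .inr j ∧ i ≤ j ∧ j < i + l.length := by
  induction l generalizing i with
  | nil => simp [outputs] at h
  | cons b l ih =>
    rw [outputs, List.mem_append] at h
    rcases h with h | h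
    · exact ⟨i, List.eq_of_mem_replicate h, by simp⟩
    · obtain ⟨j, rfl, h₁, h₂⟩ := ih h
      exact ⟨j, rfl, by omega, by simp; omega⟩

lemma nodup_outputs {l : List (ℕ × ℕ × ℕ)} (hl : ∀ b ∈ l, b.2.2 ≤ 1) (i : ℕ) :
    (outputs i l).Nodup := by
  induction l generalizing i with
  | nil => exact List.nodup_nil
  | cons b l ih =>
    refine List.nodup_append.2 ⟨List.nodup_replicate.2 (hl b (by simp)),
      ih (fun b hb => hl b (by simp [hb])) _, ?_⟩
    rintro a ha _ hb rfl
    obtain ⟨j, hj, hij, -⟩ := exists_of_mem_outputs hb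
    rw [List.eq_of_mem_replicate ha] at hj
    injection hj
    omega

lemma Row.size_boxes_cons {n p₀ q p₁ q' pₙ : ℕ} (S : Stacking p₀ q p₁) (F : Row n p₁ q' pₙ) :
    (Row.cons S F).boxes.length = S.size + F.boxes.length := by
  simp [Row.boxes, Stacking.size]

lemma Stacking.size_box {n p₀ q pₙ : ℕ} (p r : ℕ) (F : Row n p₀ q pₙ) :
    (Stacking.box p r F).size = F.boxes.length + 1 := by
  simp [Stacking.boxes, Stacking.size]

mutual

lemma Stacking.links_wires_perm : {p q r : ℕ} → (S : Stacking p q r) → (i : ℕ) → (l : List Wire) →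
    ((S.links i l).map Prod.fst ++ S.wires i l).Perm (l ++ outputs i S.boxes)
  | _, _, _, .unit, i, l => by simp [Stacking.links, Stacking.wires, Stacking.boxes, outputs]
  | _, _, _, .box p r F, i, l => by
    have h := (F.links_wires_perm (i + 1) (l.drop p))
    have h' : (l.take p ++ l.drop p).Perm l := by rw [List.take_append_drop]
    rw [@List.perm_iff_count Wire instBEqOfDecidableEq _] at h h' ⊢
    intro w
    have h := h w
    have h' := h' w
    simp only [Stacking.links, Stacking.wires, Stacking.boxes, outputs, List.map_append,
      List.map_map, List.count_append, Function.comp_def, List.map_id'] at h h' ⊢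
    omega

lemma Row.links_wires_perm : {n p₀ q pₙ : ℕ} → (F : Row n p₀ q pₙ) → (i : ℕ) → (l : List Wire) →
    ((F.links i l).map Prod.fst ++ F.wires i l).Perm (l ++ outputs i F.boxes)
  | _, _, _, _, .nil _, i, l => by simp [Row.links, Row.wires, Row.boxes, outputs]
  | _, _, _, _, .cons S F, i, l => by
    have h₁ := (S.links_wires_perm i l)
    have h₂ := (F.links_wires_perm (i + S.size) (S.wires i l))
    rw [@List.perm_iff_count Wire instBEqOfDecidableEq _] at h₁ h₂ ⊢
    intro w
    have h₁ := h₁ w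
    have h₂ := h₂ w
    simp only [Row.links, Row.wires, Row.boxes, outputs_append, List.map_append,
      List.count_append, Stacking.size] at h₁ h₂ ⊢
    omega

end

mutual

lemma Stacking.length_wires : {p q r : ℕ} → (S : Stacking p q r) → (i : ℕ) → (l : List Wire) →
    l.length = p → (S.wires i l).length = r
  | _, _, _, .unit, _, _, h => h
  | _, _, _, .box p r F, i, l, h => by
    simp [Stacking.wires, F.length_wires (i + 1) (l.drop p) (by simp [h]), Nat.add_comm]

lemma Row.length_wires : {n p₀ q pₙ : ℕ} → (F : Row n p₀ q pₙ) → (i : ℕ) → (l : List Wire) →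
    l.length = p₀ → (F.wires i l).length = pₙ
  | _, _, _, _, .nil _, _, _, h => h
  | _, _, _, _, .cons S F, i, l, h => F.length_wires _ _ (S.length_wires i l h)

end

/-- A wire whose left end is an input or a box with number less than `i`. -/
def Wire.StartsBefore (i : ℕ) (w : Wire) : Prop := ∀ j, w = .inr j → j < i

lemma Wire.StartsBefore.mono {i j : ℕ} {w : Wire} (h : w.StartsBefore i) (hij : i ≤ j) :
    w.StartsBefore j := fun k hk => (h k hk).trans_le hij

mutual

lemma Stacking.startsBefore_wires : {p q r : ℕ} → (S : Stacking p q r) → (i : ℕ) →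
    (l : List Wire) → (∀ w ∈ l, w.StartsBefore i) → ∀ w ∈ S.wires i l, w.StartsBefore (i + S.size)
  | _, _, _, .unit, _, _, h => h
  | _, _, _, .box p r F, i, l, h => by
    intro w hw
    rw [Stacking.wires, List.mem_append] at hw
    rw [Stacking.size_box]
    rcases hw with hw | hw
    · intro j hj
      rw [List.eq_of_mem_replicate hw] at hj
      injection hj
      omega
    · have := F.startsBefore_wires (i + 1) (l.drop p)
        (fun w hw => (h w (List.mem_of_mem_drop hw)).mono (by omega)) w hw
      exact this.mono (by omega)

lemma Row.startsBefore_wires : {n p₀ q pₙ : ℕ} → (F : Row n p₀ q pₙ) → (i : ℕ) →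
    (l : List Wire) → (∀ w ∈ l, w.StartsBefore i) →
    ∀ w ∈ F.wires i l, w.StartsBefore (i + F.boxes.length)
  | _, _, _, _, .nil _, _, _, h => h
  | _, _, _, _, .cons S F, i, l, h => by
    rw [Row.size_boxes_cons, ← Nat.add_assoc]
    exact F.startsBefore_wires _ _ (S.startsBefore_wires i l h)

end

mutual

lemma Stacking.lt_of_mem_links : {p q r : ℕ} → (S : Stacking p q r) → (i : ℕ) →
    (l : List Wire) → (∀ w ∈ l, w.StartsBefore i) → ∀ x ∈ S.links i l,
      x.1.StartsBefore x.2 ∧ x.2 < i + S.size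
  | _, _, _, .unit, _, _, _ => by simp [Stacking.links]
  | _, _, _, .box p r F, i, l, h => by
    intro x hx
    rw [Stacking.links, List.mem_append] at hx
    rw [Stacking.size_box]
    rcases hx with hx | hx
    · obtain ⟨w, hw, rfl⟩ := List.mem_map.1 hx
      exact ⟨h w (List.mem_of_mem_take hw), by simp⟩
    · have := F.lt_of_mem_links (i + 1) (l.drop p)
        (fun w hw => (h w (List.mem_of_mem_drop hw)).mono (by omega)) x hx
      exact ⟨this.1, by omega⟩

lemma Row.lt_of_mem_links : {n p₀ q pₙ : ℕ} → (F : Row n p₀ q pₙ) → (i : ℕ) →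
    (l : List Wire) → (∀ w ∈ l, w.StartsBefore i) → ∀ x ∈ F.links i l,
      x.1.StartsBefore x.2 ∧ x.2 < i + F.boxes.length
  | _, _, _, _, .nil _, _, _, _ => by simp [Row.links]
  | _, _, _, _, .cons S F, i, l, h => by
    intro x hx
    rw [Row.links, List.mem_append] at hx
    rw [Row.size_boxes_cons]
    rcases hx with hx | hx
    · have := S.lt_of_mem_links i l h x hx
      exact ⟨this.1, by omega⟩
    · have := F.lt_of_mem_links _ _ (S.startsBefore_wires i l h) x hx
      exact ⟨this.1, by omega⟩

end

/-- If no box has more than one output, then every component of the horizontal composite graph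
contains exactly one output of the whole or one box without output. -/
lemma Stacking.numComponents_add_length_outputs {p q r : ℕ} (S : Stacking p q r)
    (hS : ∀ b ∈ S.boxes, b.2.2 ≤ 1) :
    S.numComponents + (outputs 0 S.boxes).length = r + S.size := by
  classical
  set l : List Wire := (List.range p).map Sum.inl with hl
  have hlen : l.length = p := by simp [hl]
  have hbefore : ∀ w ∈ l, w.StartsBefore 0 := by
    intro w hw j hj
    obtain ⟨i, -, rfl⟩ := List.mem_map.1 hw
    cases hj
  have hperm := S.links_wires_perm 0 l
  have hlt := S.lt_of_mem_links 0 l hbefore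
  have hnodup : (l ++ outputs 0 S.boxes).Nodup := by
    refine List.nodup_append.2 ⟨(List.nodup_range).map Sum.inl_injective, nodup_outputs hS 0, ?_⟩
    rintro a ha _ hb rfl
    obtain ⟨j, rfl, -⟩ := exists_of_mem_outputs hb
    simp [hl] at ha
  have hnodup' : ((S.links 0 l).map Prod.fst).Nodup :=
    (List.nodup_append.1 (hperm.nodup_iff.2 hnodup)).1
  have hfun : ∀ a b b', S.Adjacent a b → S.Adjacent a b' → b = b' := by
    rintro a _ _ ⟨j, rfl, hj⟩ ⟨j', rfl, hj'⟩
    have := List.inj_on_of_nodup_map hnodup' hj hj' rfl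
    injection this with _ this
    exact congrArg _ (Fin.ext this)
  have hcard : S.numComponents = Nat.card {a : S.Vertex // ¬ ∃ b, S.Adjacent a b} := by
    refine natCard_quot_of_functional
      (Sum.elim (fun _ => S.size + 1) fun j => S.size - j) ?_ hfun
    rintro (a | a) _ ⟨j, rfl, hj⟩
    · simp
    · have := (hlt _ hj).1 a rfl
      simp only [Sum.elim_inr]
      omega
  let ι : S.Vertex ↪ Wire := ⟨Sum.map Fin.val Fin.val,
    Sum.map_injective.2 ⟨Fin.val_injective, Fin.val_injective⟩⟩
  have himage : (Finset.univ.filter fun a : S.Vertex => ∃ b, S.Adjacent a b).map ι =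
      ((S.links 0 l).map Prod.fst).toFinset := by
    ext w
    simp only [Finset.mem_map, Finset.mem_filter, Finset.mem_univ, true_and, List.mem_toFinset,
      List.mem_map]
    constructor
    · rintro ⟨a, ⟨_, j, rfl, hj⟩, rfl⟩
      exact ⟨_, hj, rfl⟩
    · rintro ⟨⟨w, j⟩, hj, rfl⟩
      have hmem : w ∈ l ++ outputs 0 S.boxes :=
        hperm.subset (List.mem_append_left _ (List.mem_map.2 ⟨_, hj, rfl⟩))
      have hjlt : j < S.size := by simpa using (hlt _ hj).2
      rcases List.mem_append.1 hmem with h | h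
      · obtain ⟨i, hi, rfl⟩ := List.mem_map.1 h
        exact ⟨.inl ⟨i, List.mem_range.1 hi⟩, ⟨_, ⟨j, hjlt⟩, rfl, hj⟩, rfl⟩
      · obtain ⟨i, rfl, -, hi⟩ := exists_of_mem_outputs h
        exact ⟨.inr ⟨i, by simpa [Stacking.size] using hi⟩, ⟨_, ⟨j, hjlt⟩, rfl, hj⟩, rfl⟩
  have hcount : (Finset.univ.filter fun a : S.Vertex => ∃ b, S.Adjacent a b).card =
      (S.links 0 l).length := by
    rw [← Finset.card_map ι, himage, List.toFinset_card_of_nodup hnodup', List.length_map]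
  have htotal := Finset.card_filter_add_card_filter_not (s := (Finset.univ : Finset S.Vertex))
    (fun a => ∃ b, S.Adjacent a b)
  have hlength := hperm.length_eq
  simp only [List.length_append, List.length_map, S.length_wires 0 l hlen, hlen] at hlength
  rw [hcount, Finset.card_univ, Fintype.card_sum, Fintype.card_fin, Fintype.card_fin] at htotal
  rw [hcard, Nat.card_eq_fintype_card, Fintype.card_subtype]
  omega

/-! ## Stackings of multiplications, restrictions and twists -/

/-- The sizes of a multiplication, a restriction and a twist. -/
def IsPrestackBox (b : ℕ × ℕ × ℕ) : Prop := b = (0, 2, 0) ∨ b = (1, 1, 1) ∨ b = (2, 0, 1)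

namespace Stacking

/-- A multiplication with two stackings on top. -/
abbrev mulBox {p₀ q₁ p₁ q₂ p₂ : ℕ} (X : Stacking p₀ q₁ p₁) (Y : Stacking p₁ q₂ p₂) :
    Stacking (p₀ + 0) (0 + q₂ + q₁) (p₂ + 0) :=
  .box 0 0 (.cons X (.cons Y (.nil p₂)))

/-- A restriction with a stacking on top. -/
abbrev resBox {p₀ q p₁ : ℕ} (X : Stacking p₀ q p₁) : Stacking (p₀ + 1) (0 + q) (p₁ + 1) :=
  .box 1 1 (.cons X (.nil p₁))

/-- A twist, with `p` straight wires above it. -/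
abbrev twistBox (p : ℕ) : Stacking (p + 2) 0 (p + 1) := .box 2 1 (.nil p)

/-- All boxes are multiplications, restrictions or twists. -/
def IsPrestack {p q r : ℕ} (S : Stacking p q r) : Prop := ∀ b ∈ S.boxes, IsPrestackBox b

/-- The number of multiplications. -/
def numMul {p q r : ℕ} (S : Stacking p q r) : ℕ := S.boxes.count (0, 2, 0)

/-- A stacking together with its size. -/
abbrev toSigma {p q r : ℕ} (S : Stacking p q r) : Σ p q r : ℕ, Stacking p q r := ⟨p, q, r, S⟩

lemma IsPrestack.cases
    {motive : ∀ (p q r : ℕ) (S : Stacking p q r), S.IsPrestack → Prop}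
    (unit : ∀ h, motive _ _ _ .unit h)
    (mul : ∀ {p₀ q₁ p₁ q₂ p₂ : ℕ} (X : Stacking p₀ q₁ p₁) (Y : Stacking p₁ q₂ p₂),
      X.IsPrestack → Y.IsPrestack → ∀ h, motive _ _ _ (mulBox X Y) h)
    (res : ∀ {p₀ q p₁ : ℕ} (X : Stacking p₀ q p₁), X.IsPrestack →
      ∀ h, motive _ _ _ (resBox X) h)
    (twist : ∀ (p : ℕ) h, motive _ _ _ (twistBox p) h)
    {p q r : ℕ} {S : Stacking p q r} (hS : S.IsPrestack) : motive p q r S hS := by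
  cases S with
  | unit => exact unit _
  | box p r F =>
    have hS' := hS
    simp only [IsPrestack, Stacking.boxes, List.forall_mem_cons] at hS'
    obtain ⟨h | h | h, hF⟩ := hS'
    · simp only [Prod.mk.injEq] at h
      obtain ⟨rfl, rfl, rfl⟩ := h
      cases F with
      | cons X F =>
        cases F with
        | cons Y F =>
          cases F with
          | nil p₂ =>
            simp only [Row.boxes, List.forall_mem_append] at hF
            exact mul X Y hF.1 hF.2.1 _
    · simp only [Prod.mk.injEq] at h
      obtain ⟨rfl, rfl, rfl⟩ := h
      cases F with
      | cons X F =>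
        cases F with
        | nil p₂ =>
          simp only [Row.boxes, List.forall_mem_append] at hF
          exact res X hF.1 _
    · simp only [Prod.mk.injEq] at h
      obtain ⟨rfl, rfl, rfl⟩ := h
      cases F with
      | nil => exact twist _ _

lemma boxes_mulBox {p₀ q₁ p₁ q₂ p₂ : ℕ} (X : Stacking p₀ q₁ p₁) (Y : Stacking p₁ q₂ p₂) :
    (mulBox X Y).boxes = (0, 2, 0) :: (X.boxes ++ Y.boxes) := by
  simp [Stacking.boxes, Row.boxes]

lemma boxes_resBox {p₀ q p₁ : ℕ} (X : Stacking p₀ q p₁) :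
    (resBox X).boxes = (1, 1, 1) :: X.boxes := by
  simp [Stacking.boxes, Row.boxes]

lemma boxes_twistBox (p : ℕ) : (twistBox p).boxes = [(2, 0, 1)] := by
  simp [Stacking.boxes, Row.boxes]

@[simp] lemma numMul_unit : (Stacking.unit).numMul = 0 := by
  simp [numMul, Stacking.boxes]

@[simp] lemma numMul_mulBox {p₀ q₁ p₁ q₂ p₂ : ℕ} (X : Stacking p₀ q₁ p₁)
    (Y : Stacking p₁ q₂ p₂) : (mulBox X Y).numMul = X.numMul + Y.numMul + 1 := by
  simp [numMul, boxes_mulBox]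

@[simp] lemma numMul_resBox {p₀ q p₁ : ℕ} (X : Stacking p₀ q p₁) :
    (resBox X).numMul = X.numMul := by
  simp [numMul, boxes_resBox]

@[simp] lemma numMul_twistBox (p : ℕ) : (twistBox p).numMul = 0 := by
  simp [numMul, boxes_twistBox]

lemma eq_unit_of_numMul_eq_zero {p q r : ℕ} {S : Stacking p q r} (hS : S.IsPrestack)
    (h : S.numMul = 0) (hr : r = 0) : S.toSigma = Stacking.unit.toSigma := by
  induction hS using IsPrestack.cases with
  | unit => rfl
  | mul X Y => simp at h
  | res X hX => omega
  | twist p => omega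

lemma eq_mulBox_unit_unit {p q r : ℕ} {S : Stacking p q r} (hS : S.IsPrestack)
    (h : S.numMul = 1) (hr : r = 0) : S.toSigma = (mulBox .unit .unit).toSigma := by
  induction hS using IsPrestack.cases with
  | unit => simp at h
  | mul X Y hX hY =>
    simp only [numMul_mulBox] at h
    cases eq_unit_of_numMul_eq_zero hY (by omega) (by omega)
    cases eq_unit_of_numMul_eq_zero hX (by omega) (by omega)
    rfl
  | res X hX => omega
  | twist p => omega

/-- The stackings of two multiplications. -/
lemma eq_of_numMul_eq_two {p q r : ℕ} {S : Stacking p q r} (hS : S.IsPrestack)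
    (h : S.numMul = 2) (hr : r = 0) :
    S.toSigma = (mulBox (mulBox .unit .unit) .unit).toSigma ∨
      S.toSigma = (mulBox .unit (mulBox .unit .unit)).toSigma := by
  induction hS using IsPrestack.cases with
  | unit => simp at h
  | mul X Y hX hY =>
    simp only [numMul_mulBox] at h
    obtain hY' | hY' : Y.numMul = 0 ∨ Y.numMul = 1 := by omega
    · cases eq_unit_of_numMul_eq_zero hY hY' (by omega)
      cases eq_mulBox_unit_unit hX (by omega) (by omega)
      exact .inl rfl
    · cases eq_mulBox_unit_unit hY (by omega) (by omega)
      cases eq_unit_of_numMul_eq_zero hX (by omega) (by omega)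
      exact .inr rfl
  | res X hX => omega
  | twist p => omega

lemma eq_of_numMul_eq_zero_of_eq_one {p q r : ℕ} {S : Stacking p q r} (hS : S.IsPrestack)
    (h : S.numMul = 0) (hr : r = 1) :
    S.toSigma = (resBox .unit).toSigma ∨ S.toSigma = (twistBox 0).toSigma := by
  induction hS using IsPrestack.cases with
  | unit => omega
  | mul X Y => simp at h
  | res X hX =>
    simp only [numMul_resBox] at h
    cases eq_unit_of_numMul_eq_zero hX (by omega) (by omega)
    exact .inl rfl
  | twist p =>
    obtain rfl : p = 0 := by omega
    exact .inr rfl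

lemma eq_of_numMul_eq_zero_of_eq_two {p q r : ℕ} {S : Stacking p q r} (hS : S.IsPrestack)
    (h : S.numMul = 0) (hr : r = 2) :
    S.toSigma = (resBox (resBox .unit)).toSigma ∨ S.toSigma = (resBox (twistBox 0)).toSigma ∨
      S.toSigma = (twistBox 1).toSigma := by
  induction hS using IsPrestack.cases with
  | unit => omega
  | mul X Y => simp at h
  | res X hX =>
    simp only [numMul_resBox] at h
    rcases eq_of_numMul_eq_zero_of_eq_one hX (by omega) (by omega) with hX | hX <;> cases hX
    · exact .inl rfl
    · exact .inr (.inl rfl)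
  | twist p =>
    obtain rfl : p = 1 := by omega
    exact .inr (.inr rfl)

/-- The stackings with one multiplication and one output. -/
lemma eq_of_numMul_eq_one {p q r : ℕ} {S : Stacking p q r} (hS : S.IsPrestack)
    (h : S.numMul = 1) (hr : r = 1) :
    S.toSigma = (resBox (mulBox .unit .unit)).toSigma ∨
      S.toSigma = (mulBox (resBox .unit) (resBox .unit)).toSigma ∨
      S.toSigma = (mulBox (twistBox 0) (resBox .unit)).toSigma ∨
      S.toSigma = (mulBox (resBox (resBox .unit)) (twistBox 0)).toSigma ∨
      S.toSigma = (mulBox (resBox (twistBox 0)) (twistBox 0)).toSigma ∨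
      S.toSigma = (mulBox (twistBox 1) (twistBox 0)).toSigma := by
  induction hS using IsPrestack.cases with
  | unit => omega
  | mul X Y hX hY =>
    simp only [numMul_mulBox] at h
    rcases eq_of_numMul_eq_zero_of_eq_one hY (by omega) (by omega) with hY | hY <;> cases hY
    · rcases eq_of_numMul_eq_zero_of_eq_one hX (by omega) (by omega) with hX | hX <;> cases hX
      · exact .inr (.inl rfl)
      · exact .inr (.inr (.inl rfl))
    · rcases eq_of_numMul_eq_zero_of_eq_two hX (by omega) (by omega) with hX | hX | hX <;> cases hX
      · exact .inr (.inr (.inr (.inl rfl)))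
      · exact .inr (.inr (.inr (.inr (.inl rfl))))
      · exact .inr (.inr (.inr (.inr (.inr rfl))))
  | res X hX =>
    simp only [numMul_resBox] at h
    cases eq_mulBox_unit_unit hX (by omega) (by omega)
    exact .inl rfl
  | twist p => simp at h

end Stacking

mutual

lemma Stacking.IsPrestack.size_eq : {p q r : ℕ} → {S : Stacking p q r} → S.IsPrestack →
    p = r + S.boxes.count (2, 0, 1) ∧ q + S.boxes.count (2, 0, 1) = 1 + S.boxes.count (0, 2, 0)
  | _, _, _, .unit, _ => by simp [Stacking.boxes]
  | _, _, _, .box p r F, hS => by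
    simp only [Stacking.IsPrestack, Stacking.boxes, List.forall_mem_cons] at hS
    have := Row.size_eq_of_isPrestackBox hS.2
    rcases hS.1 with h | h | h <;> simp only [Prod.mk.injEq] at h <;> obtain ⟨rfl, rfl, rfl⟩ := h <;>
      simp [Stacking.boxes] <;> omega

lemma Row.size_eq_of_isPrestackBox : {n p₀ q pₙ : ℕ} → {F : Row n p₀ q pₙ} →
    (∀ b ∈ F.boxes, IsPrestackBox b) →
    p₀ = pₙ + F.boxes.count (2, 0, 1) ∧ q + F.boxes.count (2, 0, 1) = n + F.boxes.count (0, 2, 0)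
  | _, _, _, _, .nil _, _ => by simp [Row.boxes]
  | _, _, _, _, .cons S F, hF => by
    simp only [Row.boxes, List.forall_mem_append] at hF
    have h₁ := Stacking.IsPrestack.size_eq (S := S) hF.1
    have h₂ := Row.size_eq_of_isPrestackBox hF.2
    simp only [Row.boxes, List.count_append]
    omega

end

lemma length_outputs_add_count {l : List (ℕ × ℕ × ℕ)} (hl : ∀ b ∈ l, IsPrestackBox b) (i : ℕ) :
    (outputs i l).length + l.count (0, 2, 0) = l.length := by
  induction l generalizing i with
  | nil => rfl
  | cons b l ih =>
    rw [List.forall_mem_cons] at hl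
    have := ih hl.2 (i + 1)
    rcases hl.1 with rfl | rfl | rfl <;> simp [outputs] <;> omega

namespace Stacking

variable {p q r : ℕ} {S : Stacking p q r}

lemma IsPrestack.numComponents_eq (hS : S.IsPrestack) : S.numComponents = r + S.numMul := by
  have h₁ := S.numComponents_add_length_outputs fun b hb => by
    rcases hS b hb with rfl | rfl | rfl <;> simp
  have h₂ := length_outputs_add_count hS 0
  simp only [numMul, size] at *
  omega

lemma IsPrestack.sum_tdDegree (hS : S.IsPrestack) : (S.boxes.map tdDegree).sum = S.size := by
  have : S.boxes.map tdDegree = S.boxes.map fun _ => (1 : ℤ) :=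
    List.map_congr_left fun b hb => by
      rcases hS b hb with rfl | rfl | rfl <;> simp [tdDegree, IsThin]
  simp [this, size]

lemma IsPrestack.isThinQuadratic_iff (hS : S.IsPrestack) :
    S.IsThinQuadratic ↔ (r = 0 ∧ S.numMul = 2) ∨ (r = 1 ∧ S.numMul = 1) := by
  have hsemi : ∀ b ∈ S.boxes, ¬ IsSemiThin b := fun b hb => by
    rcases hS b hb with rfl | rfl | rfl <;> simp [IsSemiThin, IsThin]
  have hsize := hS.size_eq
  rw [IsThinQuadratic, degree, hS.sum_tdDegree, hS.numComponents_eq, tdDegree]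
  constructor
  · rintro ⟨hdeg, hcomp, -⟩
    simp only [IsThin, numMul] at *
    split_ifs at hdeg <;> omega
  · rintro (⟨rfl, h⟩ | ⟨rfl, h⟩)
    · refine ⟨?_, by omega, hsemi⟩
      rcases eq_of_numMul_eq_two hS h rfl with h | h <;> cases h <;> simp [IsThin]
    · refine ⟨?_, by omega, hsemi⟩
      simp only [numMul] at h
      rw [if_neg (by simp [IsThin])]
      push_cast
      omega

end Stacking

section Vanishing

variable {k : Type x} [CommRing k] {C : Type u} [Category.{v} C]
  {Q : KQuiver.{v, u, w, w', x} k C}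

namespace ArrowPath

/-- One of the arrows of the path is zero. -/
def HasZero {U : C} : {q : ℕ} → {A B : Q.Ob U} → ArrowPath Q U q A B → Prop
  | _, _, _, .nil _ => False
  | _, _, _, .cons a P => a = 0 ∨ P.HasZero

lemma HasZero.castEnd {U : C} {q : ℕ} {A B B' : Q.Ob U} {P : ArrowPath Q U q A B}
    (hP : P.HasZero) (h : B = B') : (P.castEnd h).HasZero := by
  subst h; exact hP

lemma IsMultilinear.eq_zero_of_hasZero {U : C} {M : Q.Ob U → Type w'}
    [∀ B, AddCommGroup (M B)] [∀ B, Module k (M B)] {q : ℕ} {A B : Q.Ob U}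
    {φ : ∀ B, ArrowPath Q U q A B → M B} (hφ : IsMultilinear φ) {P : ArrowPath Q U q A B}
    (hP : P.HasZero) : φ B P = 0 := by
  induction P with
  | nil => exact hP.elim
  | cons a P ih =>
    rcases hP with rfl | hP
    · exact ((hφ _).1 _ P).map_zero
    · exact ih ((hφ _).2 a) hP

end ArrowPath

lemma RawCochain.zero_comp {p n r p₀ q pₙ : ℕ} (Θ : Tensor Q n p₀ q pₙ) :
    (0 : RawCochain Q p n r).comp Θ = 0 := by
  funext V U σ f A B P
  simp [RawCochain.comp]

lemma RawCochain.comp_eq_zero {p n r p₀ q pₙ : ℕ} {θ : RawCochain Q p n r}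
    (hθ : θ ∈ Cochain Q p n r) {Θ : Tensor Q n p₀ q pₙ}
    (hΘ : ∀ V U σ f A B P, ∀ T ∈ Θ V U σ f A B P, T.HasZero) : θ.comp Θ = 0 := by
  funext V U σ f A B P
  refine List.sum_eq_zero fun x hx => ?_
  obtain ⟨g, -, rfl⟩ := List.mem_map.1 hx
  refine List.sum_eq_zero fun x hx => ?_
  obtain ⟨h, -, rfl⟩ := List.mem_map.1 hx
  split_ifs with e
  · refine List.sum_eq_zero fun x hx => ?_
    obtain ⟨T, hT, rfl⟩ := List.mem_map.1 hx
    rw [(hθ V _ (σ.take p) g _).eq_zero_of_hasZero (hΘ _ _ _ _ _ _ _ T hT), map_zero]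
  · rfl

variable {θ : ℕ → ∀ p q r, RawCochain Q p q r}

mutual

lemma Stacking.eval_eq_zero (hθ : ∀ i p q r, θ i p q r ∈ Cochain Q p q r)
    (hθ' : ∀ i p q r, ¬ IsPrestackBox (p, q, r) → θ i p q r = 0) :
    {p q r : ℕ} → (S : Stacking p q r) → ¬ S.IsPrestack → (i : ℕ) → S.eval θ i = 0
  | _, _, _, .unit, hS, _ => (hS (by simp [Stacking.IsPrestack, Stacking.boxes])).elim
  | _, _, _, .box (n := n) p r F, hS, i => by
    by_cases h : IsPrestackBox (p, n, r)
    · simp only [Stacking.IsPrestack, Stacking.boxes, List.forall_mem_cons, h, true_and] at hS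
      exact RawCochain.comp_eq_zero (hθ _ _ _ _) (F.hasZero_of_mem_eval hθ hθ' hS (i + 1))
    · rw [Stacking.eval, hθ' i p n r h, RawCochain.zero_comp]

lemma Row.hasZero_of_mem_eval (hθ : ∀ i p q r, θ i p q r ∈ Cochain Q p q r)
    (hθ' : ∀ i p q r, ¬ IsPrestackBox (p, q, r) → θ i p q r = 0) :
    {n p₀ q pₙ : ℕ} → (F : Row n p₀ q pₙ) → (¬ ∀ b ∈ F.boxes, IsPrestackBox b) → (i : ℕ) →
    ∀ V U σ f A B P, ∀ T ∈ F.eval θ i V U σ f A B P, T.HasZero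
  | _, _, _, _, .nil _, hF, _ => (hF (by simp [Row.boxes])).elim
  | _, _, _, _, .cons S F, hF, i => by
    intro V U σ f A B P T hT
    rw [Row.eval, Tensor.cons] at hT
    simp only [List.mem_flatMap] at hT
    obtain ⟨f₁, -, f₂, -, hT⟩ := hT
    split_ifs at hT with h
    · obtain ⟨T', hT', rfl⟩ := List.mem_map.1 hT
      refine ArrowPath.HasZero.castEnd ?_ _
      by_cases hS : S.IsPrestack
      · refine .inr (F.hasZero_of_mem_eval hθ hθ' (fun h => hF ?_) _ _ _ _ _ _ _ _ T' hT')
        rw [Row.boxes, List.forall_mem_append]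
        exact ⟨hS, h⟩
      · left
        rw [S.eval_eq_zero hθ hθ' hS]
        rfl
    · simp at hT

end

mutual

lemma Stacking.eval_congr {θ θ' : ℕ → ∀ p q r, RawCochain Q p q r} :
    {p q r : ℕ} → (S : Stacking p q r) → (i : ℕ) →
    (∀ j, j < i + S.size → θ j = θ' j) → S.eval θ i = S.eval θ' i
  | _, _, _, .unit, _, _ => rfl
  | _, _, _, .box p r F, i, h => by
    rw [Stacking.size_box] at h
    rw [Stacking.eval, Stacking.eval, h i (by omega),
      F.eval_congr (i + 1) fun j hj => h j (by omega)]

lemma Row.eval_congr {θ θ' : ℕ → ∀ p q r, RawCochain Q p q r} :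
    {n p₀ q pₙ : ℕ} → (F : Row n p₀ q pₙ) → (i : ℕ) →
    (∀ j, j < i + F.boxes.length → θ j = θ' j) → F.eval θ i = F.eval θ' i
  | _, _, _, _, .nil _, _, _ => rfl
  | _, _, _, _, .cons S F, i, h => by
    rw [Row.size_boxes_cons] at h
    rw [Row.eval, Row.eval, S.eval_congr i fun j hj => h j (by omega),
      F.eval_congr _ fun j hj => h j (by omega)]

end

/-- The cochain `S(θ,…,θ)`. -/
def Stacking.evalDiag (θ : Tot Q) {p q r : ℕ} (S : Stacking p q r) : Cochain Q p q r :=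
  ⟨S.eval (fun _ p q r => θ p q r) 0, S.eval_mem (fun _ p q r => (θ p q r).2) 0⟩

/-- The sign of `S(θ,…,θ)` in the Maurer–Cartan expression. -/
def Stacking.mcSign {p q r : ℕ} (S : Stacking p q r) : ℤ :=
  (-1) ^ (S.size * (S.size + 1) / 2) * ((S.tdSign + S.actionSign).negOnePow : ℤ)

lemma GSObject.toTot_eq_zero {α : GSObject Q} (hα : α ∈ gsDegree Q 1) {p q r : ℕ}
    (h : ¬ IsPrestackBox (p, q, r)) : α.toTot p q r = 0 := by
  simp only [IsPrestackBox, Prod.mk.injEq] at h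
  match p, r with
  | 0, 0 => exact hα 0 q (by push_cast; omega)
  | p + 1, 1 => exact hα (p + 1) q (by push_cast; omega)
  | 0, r + 1 => rfl
  | p + 1, 0 => rfl
  | p + 1, r + 2 => rfl

set_option synthInstance.maxHeartbeats 100000 in
lemma brace_apply {θ : Tot Q} (hθ : ∀ p q r, ¬ IsPrestackBox (p, q, r) → θ p q r = 0)
    {p q r : ℕ} (T : Finset (Stacking p q r))
    (hT : ∀ S, S ∈ T ↔ S.IsPrestack ∧ S.IsThinQuadratic) (n : ℕ) :
    brace n (fun _ => θ) p q r =
      ∑ S ∈ T with S.size = n, (S.tdSign + S.actionSign).negOnePow • S.evalDiag θ := by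
  classical
  have hmem : ∀ i p q r, (fun i p q r => if _ : i < n then (θ p q r : RawCochain Q p q r) else 0 :
      ℕ → ∀ p q r, RawCochain Q p q r) i p q r ∈ Cochain Q p q r := by
    intro i p q r
    dsimp only
    split_ifs
    · exact (θ p q r).2
    · exact Submodule.zero_mem _
  rw [brace, finsum_subtype_eq_finsum_cond
    (f := fun S : Stacking p q r => (S.tdSign + S.actionSign).negOnePow •
      (⟨S.eval (fun i p q r => if _ : i < n then (θ p q r : RawCochain Q p q r) else 0) 0,
        S.eval_mem hmem 0⟩ : Cochain Q p q r))
    (fun S : Stacking p q r => S.size = n ∧ S.IsThinQuadratic)]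
  rw [finsum_cond_eq_sum_of_cond_iff (p := fun S : Stacking p q r => S.size = n ∧ S.IsThinQuadratic)
    _ (t := T.filter fun S => S.size = n)]
  · refine Finset.sum_congr rfl fun S hS => ?_
    congr 1
    refine Subtype.ext (S.eval_congr 0 fun j hj => ?_)
    have := (Finset.mem_filter.1 hS).2
    funext p q r
    rw [dif_pos (by omega)]
  · intro S hS
    have : S.IsPrestack := by
      by_contra h
      refine hS ?_
      have h0 := S.eval_eq_zero hmem (fun i p q r h => ?_) h 0
      · have : (⟨S.eval (fun i p q r => if _ : i < n then (θ p q r : RawCochain Q p q r) else 0) 0,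
          S.eval_mem hmem 0⟩ : Cochain Q p q r) = 0 := Subtype.ext h0
        rw [this, smul_zero]
      · simp [hθ p q r h]
    rw [Finset.mem_filter, hT]
    tauto

lemma Stacking.finite_isThinQuadratic (p q r : ℕ) :
    {S : Stacking p q r | S.IsPrestack ∧ S.IsThinQuadratic}.Finite := by
  let L : Set (Σ p q r : ℕ, Stacking p q r) :=
    {(mulBox (mulBox .unit .unit) .unit).toSigma, (mulBox .unit (mulBox .unit .unit)).toSigma,
      (resBox (mulBox .unit .unit)).toSigma, (mulBox (resBox .unit) (resBox .unit)).toSigma,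
      (mulBox (twistBox 0) (resBox .unit)).toSigma,
      (mulBox (resBox (resBox .unit)) (twistBox 0)).toSigma,
      (mulBox (resBox (twistBox 0)) (twistBox 0)).toSigma,
      (mulBox (twistBox 1) (twistBox 0)).toSigma}
  have hL : L.Finite := Set.toFinite _
  refine (hL.preimage (f := fun S : Stacking p q r => S.toSigma) ?_).subset ?_
  · intro S _ S' _ h
    simpa using h
  · rintro S ⟨hS, h⟩
    rcases hS.isThinQuadratic_iff.1 h with ⟨hr, h⟩ | ⟨hr, h⟩
    · have := eq_of_numMul_eq_two hS h hr
      simp only [L, Set.mem_preimage, Set.mem_insert_iff, Set.mem_singleton_iff]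
      tauto
    · have := eq_of_numMul_eq_one hS h hr
      simp only [L, Set.mem_preimage, Set.mem_insert_iff, Set.mem_singleton_iff]
      tauto

lemma Stacking.size_of_isThinQuadratic {p q r : ℕ} {S : Stacking p q r} (hS : S.IsPrestack)
    (h : S.IsThinQuadratic) : S.size = 2 ∨ S.size = 3 ∨ S.size = 4 := by
  rcases hS.isThinQuadratic_iff.1 h with ⟨hr, h⟩ | ⟨hr, h⟩
  · rcases eq_of_numMul_eq_two hS h hr with h | h <;> cases h <;>
      simp [size, Stacking.boxes, Row.boxes]
  · rcases eq_of_numMul_eq_one hS h hr with h | h | h | h | h | h <;> cases h <;>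
      simp [size, Stacking.boxes, Row.boxes]

lemma brace_eq_zero {θ : Tot Q} (hθ : ∀ p q r, ¬ IsPrestackBox (p, q, r) → θ p q r = 0) {n : ℕ}
    (hn : 5 ≤ n) : brace n (fun _ => θ) = 0 := by
  funext p q r
  have hfin := Stacking.finite_isThinQuadratic p q r
  rw [brace_apply hθ hfin.toFinset (by simp), Finset.filter_false_of_mem, Finset.sum_empty]
  · rfl
  · intro S hS
    rw [Set.Finite.mem_toFinset] at hS
    have := Stacking.size_of_isThinQuadratic hS.1 hS.2
    omega

set_option synthInstance.maxHeartbeats 100000 in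
lemma maurerCartan_apply {θ : Tot Q} (hθ : ∀ p q r, ¬ IsPrestackBox (p, q, r) → θ p q r = 0)
    {p q r : ℕ} (T : Finset (Stacking p q r))
    (hT : ∀ S, S ∈ T ↔ S.IsPrestack ∧ S.IsThinQuadratic) :
    maurerCartan θ p q r = ∑ S ∈ T, S.mcSign • S.evalDiag θ := by
  rw [maurerCartan, finsum_cond_eq_sum_of_cond_iff (t := {2, 3, 4})]
  · have hmaps : ∀ S ∈ T, S.size ∈ ({2, 3, 4} : Finset ℕ) := by
      intro S hS
      have := Stacking.size_of_isThinQuadratic ((hT S).1 hS).1 ((hT S).1 hS).2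
      simpa using this
    rw [Finset.sum_apply, Finset.sum_apply, Finset.sum_apply,
      ← Finset.sum_fiberwise_of_maps_to hmaps]
    refine Finset.sum_congr rfl fun n _ => ?_
    rw [Pi.smul_apply, Pi.smul_apply, Pi.smul_apply, brace_apply hθ T hT, Finset.smul_sum]
    refine Finset.sum_congr rfl fun S hS => ?_
    rw [Units.smul_def, smul_smul, Stacking.mcSign, (Finset.mem_filter.1 hS).2]
  · intro n hn
    have : n < 5 := by
      by_contra h
      exact hn (by rw [brace_eq_zero hθ (by omega), smul_zero])
    simp only [Finset.mem_insert, Finset.mem_singleton]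
    omega

lemma maurerCartan_apply_eq_zero_iff {θ : Tot Q}
    (hθ : ∀ p q r, ¬ IsPrestackBox (p, q, r) → θ p q r = 0) {p q r : ℕ}
    {S₁ S₂ : Stacking p q r} (hsign : S₁.mcSign * S₂.mcSign = -1)
    (hS : ∀ S : Stacking p q r, S = S₁ ∨ S = S₂ ↔ S.IsPrestack ∧ S.IsThinQuadratic) :
    maurerCartan θ p q r = 0 ↔
      S₁.eval (fun _ p q r => θ p q r) 0 =
        (S₂.eval (fun _ p q r => θ p q r) 0 : RawCochain Q p q r) := by
  classical
  have hne : S₁ ≠ S₂ := by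
    rintro rfl
    nlinarith [mul_self_nonneg S₁.mcSign]
  rw [maurerCartan_apply hθ {S₁, S₂} (by simpa using hS), Finset.sum_pair hne]
  have key : S₁.mcSign • S₁.evalDiag θ + S₂.mcSign • S₂.evalDiag θ = 0 ↔
      S₁.evalDiag θ = S₂.evalDiag θ := by
    rcases Int.mul_eq_neg_one_iff_eq_one_or_neg_one.1 hsign with ⟨h₁, h₂⟩ | ⟨h₁, h₂⟩ <;>
      rw [h₁, h₂]
    · rw [one_smul, neg_smul, one_smul, ← sub_eq_add_neg, sub_eq_zero]
    · rw [one_smul, neg_smul, one_smul, neg_add_eq_sub, sub_eq_zero, eq_comm]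
  rw [key, Subtype.ext_iff]
  rfl

end Vanishing

/-! ## The components of the Maurer–Cartan expression -/

namespace Stacking

lemma isThinQuadratic_iff_toSigma {p q r : ℕ} (S : Stacking p q r) :
    S.IsPrestack ∧ S.IsThinQuadratic ↔
      S.toSigma = (mulBox (mulBox .unit .unit) .unit).toSigma ∨
      S.toSigma = (mulBox .unit (mulBox .unit .unit)).toSigma ∨
      S.toSigma = (resBox (mulBox .unit .unit)).toSigma ∨
      S.toSigma = (mulBox (resBox .unit) (resBox .unit)).toSigma ∨
      S.toSigma = (mulBox (twistBox 0) (resBox .unit)).toSigma ∨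
      S.toSigma = (mulBox (resBox (resBox .unit)) (twistBox 0)).toSigma ∨
      S.toSigma = (mulBox (resBox (twistBox 0)) (twistBox 0)).toSigma ∨
      S.toSigma = (mulBox (twistBox 1) (twistBox 0)).toSigma := by
  constructor
  · rintro ⟨hS, h⟩
    rcases hS.isThinQuadratic_iff.1 h with ⟨hr, h⟩ | ⟨hr, h⟩
    · have := eq_of_numMul_eq_two hS h hr
      tauto
    · exact .inr (.inr (eq_of_numMul_eq_one hS h hr))
  · have key : S.IsPrestack → (r = 0 ∧ S.numMul = 2) ∨ (r = 1 ∧ S.numMul = 1) →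
        S.IsPrestack ∧ S.IsThinQuadratic := fun hS h => ⟨hS, hS.isThinQuadratic_iff.2 h⟩
    rintro (h | h | h | h | h | h | h | h) <;> cases h <;>
      exact key (by simp [IsPrestack, IsPrestackBox, Stacking.boxes, Row.boxes]) (by simp)

lemma eq_or_eq_iff_isThinQuadratic_zero_three (S : Stacking 0 3 0) :
    S = mulBox (mulBox .unit .unit) .unit ∨ S = mulBox .unit (mulBox .unit .unit) ↔
      S.IsPrestack ∧ S.IsThinQuadratic := by
  rw [isThinQuadratic_iff_toSigma]
  simp [toSigma]

lemma eq_or_eq_iff_isThinQuadratic_one_two (S : Stacking 1 2 1) :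
    S = resBox (mulBox .unit .unit) ∨ S = mulBox (resBox .unit) (resBox .unit) ↔
      S.IsPrestack ∧ S.IsThinQuadratic := by
  rw [isThinQuadratic_iff_toSigma]
  simp [toSigma]

lemma eq_or_eq_iff_isThinQuadratic_two_one (S : Stacking 2 1 1) :
    S = mulBox (resBox (resBox .unit)) (twistBox 0) ∨ S = mulBox (twistBox 0) (resBox .unit) ↔
      S.IsPrestack ∧ S.IsThinQuadratic := by
  rw [isThinQuadratic_iff_toSigma]
  simp [toSigma, or_comm]

lemma eq_or_eq_iff_isThinQuadratic_three_zero (S : Stacking 3 0 1) :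
    S = mulBox (twistBox 1) (twistBox 0) ∨ S = mulBox (resBox (twistBox 0)) (twistBox 0) ↔
      S.IsPrestack ∧ S.IsThinQuadratic := by
  rw [isThinQuadratic_iff_toSigma]
  simp [toSigma, or_comm]

lemma mcSign_mul_mcSign_zero_three :
    mcSign (p := 0) (q := 3) (r := 0) (mulBox (mulBox .unit .unit) .unit) *
      mcSign (p := 0) (q := 3) (r := 0) (mulBox .unit (mulBox .unit .unit)) = -1 := by
  decide

lemma mcSign_mul_mcSign_one_two :
    mcSign (p := 1) (q := 2) (r := 1) (resBox (mulBox .unit .unit)) *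
      mcSign (p := 1) (q := 2) (r := 1) (mulBox (resBox .unit) (resBox .unit)) = -1 := by
  decide

lemma mcSign_mul_mcSign_two_one :
    mcSign (p := 2) (q := 1) (r := 1) (mulBox (resBox (resBox .unit)) (twistBox 0)) *
      mcSign (p := 2) (q := 1) (r := 1) (mulBox (twistBox 0) (resBox .unit)) = -1 := by
  decide

lemma mcSign_mul_mcSign_three_zero :
    mcSign (p := 3) (q := 0) (r := 1) (mulBox (twistBox 1) (twistBox 0)) *
      mcSign (p := 3) (q := 0) (r := 1) (mulBox (resBox (twistBox 0)) (twistBox 0)) = -1 := by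
  decide

end Stacking

section Components

open Stacking

variable {k : Type x} [CommRing k] {C : Type u} [Category.{v} C]
  {Q : KQuiver.{v, u, w, w', x} k C}

lemma add_zero_add_zero_add_zero {M : Type*} [AddMonoid M] (a : M) : a + 0 + 0 + 0 = a := by
  simp only [add_zero]

lemma add_add_zero_add_zero_add_zero {M : Type*} [AddMonoid M] (a b : M) :
    a + (b + 0) + 0 + 0 = a + b := by
  simp only [add_zero]

lemma mul_castEnd (m : Cochain Q 0 2 0) {U : C} {A B D D' : Q.Ob U} (a : Q.Hom U A B)
    (b : Q.Hom U B D) (h : D = D') :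
    m.1 U U (.nil U) .nil A D' ((ArrowPath.cons a (.cons b (.nil D))).castEnd h) =
      Q.castHom rfl h (mul m a b) := by
  subst h; rfl

lemma zero_mul_eq_zero (m : Cochain Q 0 2 0) {U : C} {A B D : Q.Ob U} (b : Q.Hom U B D) :
    mul m (0 : Q.Hom U A B) b = 0 :=
  (m.2 U U (.nil U) .nil A).eq_zero_of_hasZero (.inl rfl)

variable (α : GSObject Q)

/-- The values of the cochain `S(α,…,α)`, the boxes of `S` being numbered from `i` on. -/
abbrev GSObject.evalAt (i : ℕ) {p q r : ℕ} (S : Stacking p q r) : RawCochain Q p q r :=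
  S.eval (fun _ p q r => α.toTot p q r) i

variable (i : ℕ)

lemma evalAt_mul {U : C} {A₀ A₁ A₂ : Q.Ob U} (a : Q.Hom U A₀ A₁) (b : Q.Hom U A₁ A₂) :
    α.evalAt i (mulBox .unit .unit) U U (.nil U) .nil A₀ A₂ (.cons a (.cons b (.nil A₂))) =
      mul (α 0 2) a b :=
  add_zero_add_zero_add_zero (mul (α 0 2) a b)

lemma evalAt_res {V U : C} (u : V ⟶ U) {A B : Q.Ob U} (a : Q.Hom U A B) :
    α.evalAt i (resBox .unit) V U (.cons u (.nil U)) (.keep .nil) A B (.cons a (.nil B)) =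
      res (α 1 1) u a :=
  add_zero_add_zero_add_zero (res (α 1 1) u a)

lemma evalAt_twist {W V U : C} (v : W ⟶ V) (u : V ⟶ U) (A : Q.Ob U) :
    α.evalAt i (twistBox 0) W U (.cons v (.cons u (.nil U))) (.merge (.keep .nil)) A A (.nil A) =
      twist (α 2 0) v u A :=
  add_zero_add_zero_add_zero (twist (α 2 0) v u A)

lemma evalAt_mulBox_zero_three (X : Stacking 0 2 0) (Y : Stacking 0 1 0) {U : C}
    {A₀ A₁ A₂ A₃ : Q.Ob U} (a : Q.Hom U A₀ A₁) (b : Q.Hom U A₁ A₂) (d : Q.Hom U A₂ A₃) :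
    α.evalAt i (mulBox X Y) U U (.nil U) .nil A₀ A₃ (.cons a (.cons b (.cons d (.nil A₃)))) =
      mul (α 0 2) (α.evalAt (i + 1) X U U (.nil U) .nil A₀ A₂ (.cons a (.cons b (.nil A₂))))
        (α.evalAt (i + 1 + X.size) Y U U (.nil U) .nil A₂ A₃ (.cons d (.nil A₃))) :=
  add_zero_add_zero_add_zero (mul (α 0 2) _ _)

lemma evalAt_mulBox_zero_three' (X : Stacking 0 1 0) (Y : Stacking 0 2 0) {U : C}
    {A₀ A₁ A₂ A₃ : Q.Ob U} (a : Q.Hom U A₀ A₁) (b : Q.Hom U A₁ A₂) (d : Q.Hom U A₂ A₃) :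
    α.evalAt i (mulBox X Y) U U (.nil U) .nil A₀ A₃ (.cons a (.cons b (.cons d (.nil A₃)))) =
      mul (α 0 2) (α.evalAt (i + 1) X U U (.nil U) .nil A₀ A₁ (.cons a (.nil A₁)))
        (α.evalAt (i + 1 + X.size) Y U U (.nil U) .nil A₁ A₃ (.cons b (.cons d (.nil A₃)))) :=
  add_zero_add_zero_add_zero (mul (α 0 2) _ _)

lemma evalAt_mul_mul_unit {U : C} {A₀ A₁ A₂ A₃ : Q.Ob U} (a : Q.Hom U A₀ A₁) (b : Q.Hom U A₁ A₂)
    (d : Q.Hom U A₂ A₃) :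
    α.evalAt i (mulBox (mulBox .unit .unit) .unit) U U (.nil U) .nil A₀ A₃
      (.cons a (.cons b (.cons d (.nil A₃)))) = mul (α 0 2) (mul (α 0 2) a b) d :=
  (evalAt_mulBox_zero_three α i (mulBox .unit .unit) .unit a b d).trans
    (congrArg (mul (α 0 2) · d) (evalAt_mul α (i + 1) a b))

lemma evalAt_mul_unit_mul {U : C} {A₀ A₁ A₂ A₃ : Q.Ob U} (a : Q.Hom U A₀ A₁) (b : Q.Hom U A₁ A₂)
    (d : Q.Hom U A₂ A₃) :
    α.evalAt i (mulBox .unit (mulBox .unit .unit)) U U (.nil U) .nil A₀ A₃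
      (.cons a (.cons b (.cons d (.nil A₃)))) = mul (α 0 2) a (mul (α 0 2) b d) :=
  (evalAt_mulBox_zero_three' α i .unit (mulBox .unit .unit) a b d).trans
    (congrArg (mul (α 0 2) a) (evalAt_mul α _ b d))

lemma evalAt_resBox_one_two (X : Stacking 0 2 0) {V U : C} (u : V ⟶ U) {A₀ A₁ A₂ : Q.Ob U}
    (a : Q.Hom U A₀ A₁) (b : Q.Hom U A₁ A₂) :
    α.evalAt i (resBox X) V U (.cons u (.nil U)) (.keep .nil) A₀ A₂ (.cons a (.cons b (.nil A₂))) =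
      res (α 1 1) u
        (α.evalAt (i + 1) X U U (.nil U) .nil A₀ A₂ (.cons a (.cons b (.nil A₂)))) :=
  add_zero_add_zero_add_zero (res (α 1 1) u _)

lemma evalAt_res_mul {V U : C} (u : V ⟶ U) {A₀ A₁ A₂ : Q.Ob U} (a : Q.Hom U A₀ A₁)
    (b : Q.Hom U A₁ A₂) :
    α.evalAt i (resBox (mulBox .unit .unit)) V U (.cons u (.nil U))
      (.keep .nil) A₀ A₂ (.cons a (.cons b (.nil A₂))) = res (α 1 1) u (mul (α 0 2) a b) :=
  (evalAt_resBox_one_two α i (mulBox .unit .unit) u a b).trans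
    (congrArg (res (α 1 1) u) (evalAt_mul α (i + 1) a b))

lemma evalAt_mulBox_one_two (X Y : Stacking 1 1 1) {V U : C} (u : V ⟶ U) {A₀ A₁ A₂ : Q.Ob U}
    (a : Q.Hom U A₀ A₁) (b : Q.Hom U A₁ A₂) :
    α.evalAt i (mulBox X Y) V U (.cons u (.nil U)) (.keep .nil) A₀ A₂ (.cons a (.cons b (.nil A₂))) =
      mul (α 0 2)
        (α.evalAt (i + 1) X V U (.cons u (.nil U)) (.keep .nil) A₀ A₁ (.cons a (.nil A₁)))
        (α.evalAt (i + 1 + X.size) Y V U (.cons u (.nil U)) (.keep .nil) A₁ A₂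
          (.cons b (.nil A₂))) :=
  add_zero_add_zero_add_zero (mul (α 0 2) _ _)

lemma evalAt_mul_res_res {V U : C} (u : V ⟶ U) {A₀ A₁ A₂ : Q.Ob U} (a : Q.Hom U A₀ A₁)
    (b : Q.Hom U A₁ A₂) :
    α.evalAt i (mulBox (resBox .unit) (resBox .unit)) V U
      (.cons u (.nil U)) (.keep .nil) A₀ A₂ (.cons a (.cons b (.nil A₂))) =
      mul (α 0 2) (res (α 1 1) u a) (res (α 1 1) u b) :=
  (evalAt_mulBox_one_two α i (resBox .unit) (resBox .unit) u a b).trans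
    (congrArg₂ (mul (α 0 2)) (evalAt_res α _ u a) (evalAt_res α _ u b))

lemma evalAt_resBox_two_one (X : Stacking 1 1 1) {W V U : C} (v : W ⟶ V) (u : V ⟶ U) {A B : Q.Ob U}
    (a : Q.Hom U A B) :
    α.evalAt i (resBox X) W U (.cons v (.cons u (.nil U))) (.keep (.keep .nil)) A B
      (.cons a (.nil B)) =
      res (α 1 1) v
        (α.evalAt (i + 1) X V U (.cons u (.nil U)) (.keep .nil) A B (.cons a (.nil B))) :=
  add_zero_add_zero_add_zero (res (α 1 1) v _)

lemma evalAt_mulBox_two_one (X : Stacking 2 1 2) (Y : Stacking 2 0 1) {W V U : C} (v : W ⟶ V)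
    (u : V ⟶ U) {A B : Q.Ob U} (a : Q.Hom U A B) :
    α.evalAt i (mulBox X Y) W U (.cons v (.cons u (.nil U))) (.merge (.keep .nil)) A B
      (.cons a (.nil B)) =
      mul (α 0 2)
        (α.evalAt (i + 1) X W U (.cons v (.cons u (.nil U))) (.keep (.keep .nil)) A B
          (.cons a (.nil B)))
        (α.evalAt (i + 1 + X.size) Y W U (.cons v (.cons u (.nil U))) (.merge (.keep .nil)) B B
          (.nil B)) :=
  add_zero_add_zero_add_zero (mul (α 0 2) _ _)

lemma evalAt_mulBox_two_one' (X : Stacking 2 0 1) (Y : Stacking 1 1 1) {W V U : C} (v : W ⟶ V)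
    (u : V ⟶ U) {A B : Q.Ob U} (a : Q.Hom U A B) :
    α.evalAt i (mulBox X Y) W U (.cons v (.cons u (.nil U))) (.merge (.keep .nil)) A B
      (.cons a (.nil B)) =
      mul (α 0 2)
        (α.evalAt (i + 1) X W U (.cons v (.cons u (.nil U))) (.merge (.keep .nil)) A A (.nil A))
        (α.evalAt (i + 1 + X.size) Y W U (.cons (v ≫ u) (.nil U)) (.keep .nil) A B
          (.cons a (.nil B))) :=
  add_zero_add_zero_add_zero (mul (α 0 2) _ _)

lemma evalAt_mul_res_res_twist {W V U : C} (v : W ⟶ V) (u : V ⟶ U) {A B : Q.Ob U}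
    (a : Q.Hom U A B) :
    α.evalAt i (mulBox (resBox (resBox .unit)) (twistBox 0)) W U
      (.cons v (.cons u (.nil U))) (.merge (.keep .nil)) A B (.cons a (.nil B)) =
      mul (α 0 2) (res (α 1 1) v (res (α 1 1) u a)) (twist (α 2 0) v u B) :=
  (evalAt_mulBox_two_one α i (resBox (resBox .unit)) (twistBox 0) v u a).trans
    (congrArg₂ (mul (α 0 2)) ((evalAt_resBox_two_one α _ (resBox .unit) v u a).trans
      (congrArg (res (α 1 1) v) (evalAt_res α _ u a))) (evalAt_twist α _ v u B))

lemma evalAt_mul_twist_res {W V U : C} (v : W ⟶ V) (u : V ⟶ U) {A B : Q.Ob U}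
    (a : Q.Hom U A B) :
    α.evalAt i (mulBox (twistBox 0) (resBox .unit)) W U
      (.cons v (.cons u (.nil U))) (.merge (.keep .nil)) A B (.cons a (.nil B)) =
      mul (α 0 2) (twist (α 2 0) v u A) (res (α 1 1) (v ≫ u) a) :=
  (evalAt_mulBox_two_one' α i (twistBox 0) (resBox .unit) v u a).trans
    (congrArg₂ (mul (α 0 2)) (evalAt_twist α _ v u A) (evalAt_res α _ (v ≫ u) a))

section ThreeZero

variable {T W V U : C} (w : T ⟶ W) (v : W ⟶ V) (u : V ⟶ U) (A : Q.Ob U)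

lemma KQuiver.pull_assoc : Q.pull ((w ≫ v) ≫ u) A = Q.pull (w ≫ v ≫ u) A := by
  rw [Category.assoc]

lemma evalAt_mulBox_three_zero (X : Stacking 3 0 2) (Y : Stacking 2 0 1) :
    α.evalAt i (mulBox X Y) T U (.cons w (.cons v (.cons u (.nil U))))
      (.merge (.merge (.keep .nil))) A A (.nil A) =
      mul (α 0 2) (D := Q.pull (w ≫ v ≫ u) A)
        (α.evalAt (i + 1) X T U (.cons w (.cons v (.cons u (.nil U)))) (.keep (.merge (.keep .nil)))
          A A (.nil A))
        (α.evalAt (i + 1 + X.size) Y T U (.cons w (.cons (v ≫ u) (.nil U))) (.merge (.keep .nil))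
          A A (.nil A)) +
      Q.castHom rfl (KQuiver.pull_assoc w v u A) (mul (α 0 2)
        (α.evalAt (i + 1) X T U (.cons w (.cons v (.cons u (.nil U)))) (.merge (.keep (.keep .nil)))
          A A (.nil A))
        (α.evalAt (i + 1 + X.size) Y T U (.cons (w ≫ v) (.cons u (.nil U))) (.merge (.keep .nil))
          A A (.nil A))) := by
  have h := congrArg (mul (α 0 2) (D := Q.pull (w ≫ v ≫ u) A)
        (α.evalAt (i + 1) X T U (.cons w (.cons v (.cons u (.nil U)))) (.keep (.merge (.keep .nil)))
          A A (.nil A))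
        (α.evalAt (i + 1 + X.size) Y T U (.cons w (.cons (v ≫ u) (.nil U))) (.merge (.keep .nil))
          A A (.nil A)) + ·)
    (mul_castEnd (α 0 2)
      (α.evalAt (i + 1) X T U (.cons w (.cons v (.cons u (.nil U)))) (.merge (.keep (.keep .nil)))
        A A (.nil A))
      (α.evalAt (i + 1 + X.size) Y T U (.cons (w ≫ v) (.cons u (.nil U))) (.merge (.keep .nil))
        A A (.nil A)) (KQuiver.pull_assoc w v u A))
  exact (add_add_zero_add_zero_add_zero _ _).trans h

lemma evalAt_twist_wire_keep :
    α.evalAt i (twistBox 1) T U (.cons w (.cons v (.cons u (.nil U))))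
      (.keep (.merge (.keep .nil))) A A (.nil A) = 0 :=
  (add_zero (0 + 0)).trans (add_zero 0)

lemma evalAt_twist_wire_merge :
    α.evalAt i (twistBox 1) T U (.cons w (.cons v (.cons u (.nil U))))
      (.merge (.keep (.keep .nil))) A A (.nil A) = twist (α 2 0) w v (Q.pull u A) :=
  add_zero_add_zero_add_zero (twist (α 2 0) w v (Q.pull u A))

lemma evalAt_resBox_keep (X : Stacking 2 0 1) :
    α.evalAt i (resBox X) T U (.cons w (.cons v (.cons u (.nil U))))
      (.keep (.merge (.keep .nil))) A A (.nil A) =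
      res (α 1 1) w (α.evalAt (i + 1) X W U (.cons v (.cons u (.nil U))) (.merge (.keep .nil)) A A
        (.nil A)) :=
  add_zero_add_zero_add_zero (res (α 1 1) w _)

lemma evalAt_resBox_merge (X : Stacking 2 0 1) :
    α.evalAt i (resBox X) T U (.cons w (.cons v (.cons u (.nil U))))
      (.merge (.keep (.keep .nil))) A A (.nil A) = 0 :=
  (add_zero (0 + 0)).trans (add_zero 0)

lemma evalAt_mul_twist_twist :
    α.evalAt i (mulBox (twistBox 1) (twistBox 0)) T U (.cons w (.cons v (.cons u (.nil U))))
      (.merge (.merge (.keep .nil))) A A (.nil A) =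
      Q.castHom rfl (KQuiver.pull_assoc w v u A)
        (mul (α 0 2) (twist (α 2 0) w v (Q.pull u A)) (twist (α 2 0) (w ≫ v) u A)) := by
  rw [evalAt_mulBox_three_zero, evalAt_twist_wire_keep, evalAt_twist_wire_merge, evalAt_twist,
    evalAt_twist]
  exact (congrArg (· + _) (zero_mul_eq_zero _ _)).trans (zero_add _)

lemma evalAt_mul_res_twist_twist :
    α.evalAt i (mulBox (resBox (twistBox 0)) (twistBox 0)) T U
      (.cons w (.cons v (.cons u (.nil U)))) (.merge (.merge (.keep .nil))) A A (.nil A) =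
      mul (α 0 2) (res (α 1 1) w (twist (α 2 0) v u A)) (twist (α 2 0) w (v ≫ u) A) := by
  rw [evalAt_mulBox_three_zero, evalAt_resBox_keep, evalAt_resBox_merge, evalAt_twist,
    evalAt_twist, evalAt_twist]
  exact (congrArg (_ + ·) ((congrArg _ (zero_mul_eq_zero _ _)).trans (map_zero _))).trans
    (add_zero _)

end ThreeZero

end Components

section MaurerCartan

open Stacking

variable {k : Type x} [CommRing k] {C : Type u} [Category.{v} C]
  {Q : KQuiver.{v, u, w, w', x} k C} {α : GSObject Q}

lemma maurerCartan_zero_three_eq_zero_iff (hα : α ∈ gsDegree Q 1) :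
    maurerCartan α.toTot 0 3 0 = 0 ↔ IsAssociative (α 0 2) := by
  rw [maurerCartan_apply_eq_zero_iff (fun _ _ _ => GSObject.toTot_eq_zero hα)
    mcSign_mul_mcSign_zero_three eq_or_eq_iff_isThinQuadratic_zero_three]
  constructor
  · intro h U A₀ A₁ A₂ A₃ a b d
    rw [← evalAt_mul_mul_unit α 0, ← evalAt_mul_unit_mul α 0]
    exact congrFun (congrFun (congrFun (congrFun (congrFun (congrFun (congrFun h _) _) _) _) _) _) _
  · intro h
    funext V U σ f A B P
    cases σ with
    | nil =>
    cases f with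
    | nil =>
    cases P with
    | cons a P =>
    cases P with
    | cons b P =>
    cases P with
    | cons d P =>
    cases P with
    | nil =>
    exact (evalAt_mul_mul_unit α 0 a b d).trans
      ((h _ _ _ _ _ a b d).trans (evalAt_mul_unit_mul α 0 a b d).symm)

lemma maurerCartan_one_two_eq_zero_iff (hα : α ∈ gsDegree Q 1) :
    maurerCartan α.toTot 1 2 1 = 0 ↔ IsFunctorial (α 0 2) (α 1 1) := by
  rw [maurerCartan_apply_eq_zero_iff (fun _ _ _ => GSObject.toTot_eq_zero hα)
    mcSign_mul_mcSign_one_two eq_or_eq_iff_isThinQuadratic_one_two]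
  constructor
  · intro h V U u A₀ A₁ A₂ a b
    exact (evalAt_res_mul α 0 u a b).symm.trans ((congrFun (congrFun (congrFun (congrFun (congrFun
      (congrFun (congrFun h _) _) _) _) _) _) _).trans (evalAt_mul_res_res α 0 u a b))
  · intro h
    funext V U σ f A B P
    cases σ with
    | cons u σ =>
    cases σ with
    | nil =>
    cases f with
    | merge f => cases f
    | keep f =>
    cases f with
    | nil =>
    cases P with
    | cons a P =>
    cases P with
    | cons b P =>
    cases P with
    | nil =>
    exact (evalAt_res_mul α 0 u a b).trans
      ((h _ _ u _ _ _ a b).trans (evalAt_mul_res_res α 0 u a b).symm)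

lemma maurerCartan_two_one_eq_zero_iff (hα : α ∈ gsDegree Q 1) :
    maurerCartan α.toTot 2 1 1 = 0 ↔ IsNatural (α 0 2) (α 1 1) (α 2 0) := by
  rw [maurerCartan_apply_eq_zero_iff (fun _ _ _ => GSObject.toTot_eq_zero hα)
    mcSign_mul_mcSign_two_one eq_or_eq_iff_isThinQuadratic_two_one]
  constructor
  · intro h W V U v u A B a
    exact (evalAt_mul_res_res_twist α 0 v u a).symm.trans ((congrFun (congrFun (congrFun (congrFun
      (congrFun (congrFun (congrFun h _) _) _) _) _) _) _).trans (evalAt_mul_twist_res α 0 v u a))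
  · intro h
    funext V U σ f A B P
    cases σ with
    | cons v σ =>
    cases σ with
    | cons u σ =>
    cases σ with
    | nil =>
    cases f with
    | keep f => cases f
    | merge f =>
    cases f with
    | merge f => cases f
    | keep f =>
    cases f with
    | nil =>
    cases P with
    | cons a P =>
    cases P with
    | nil =>
    exact (evalAt_mul_res_res_twist α 0 v u a).trans
      ((h _ _ _ v u _ _ a).trans (evalAt_mul_twist_res α 0 v u a).symm)

lemma maurerCartan_three_zero_eq_zero_iff (hα : α ∈ gsDegree Q 1) :
    maurerCartan α.toTot 3 0 1 = 0 ↔ IsCoherent (α 0 2) (α 1 1) (α 2 0) := by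
  rw [maurerCartan_apply_eq_zero_iff (fun _ _ _ => GSObject.toTot_eq_zero hα)
    mcSign_mul_mcSign_three_zero eq_or_eq_iff_isThinQuadratic_three_zero]
  constructor
  · intro h T W V U w v u A
    exact (evalAt_mul_twist_twist α 0 w v u A).symm.trans ((congrFun (congrFun (congrFun (congrFun
      (congrFun (congrFun (congrFun h _) _) _) _) _) _) _).trans
        (evalAt_mul_res_twist_twist α 0 w v u A))
  · intro h
    funext V U σ f A B P
    cases σ with
    | cons w σ =>
    cases σ with
    | cons v σ =>
    cases σ with
    | cons u σ =>
    cases σ with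
    | nil =>
    cases f with
    | keep f => cases f
    | merge f =>
    cases f with
    | keep f => cases f
    | merge f =>
    cases f with
    | merge f => cases f
    | keep f =>
    cases f with
    | nil =>
    cases P with
    | nil =>
    exact (evalAt_mul_twist_twist α 0 w v u _).trans
      ((h _ _ _ _ w v u _).trans (evalAt_mul_res_twist_twist α 0 w v u _).symm)

lemma maurerCartan_apply_eq_zero (hα : α ∈ gsDegree Q 1) {p q r : ℕ}
    (h : (p, q, r) ∉ ({(0, 3, 0), (1, 2, 1), (2, 1, 1), (3, 0, 1)} : Set (ℕ × ℕ × ℕ))) :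
    maurerCartan α.toTot p q r = 0 := by
  rw [maurerCartan_apply (fun _ _ _ => GSObject.toTot_eq_zero hα) ∅, Finset.sum_empty]
  intro S
  rw [isThinQuadratic_iff_toSigma]
  refine ⟨fun hS => absurd hS (Finset.notMem_empty S), fun hS => (h ?_).elim⟩
  rcases hS with hS | hS | hS | hS | hS | hS | hS | hS <;> cases hS <;> simp

lemma isMaurerCartan_iff (hα : α ∈ gsDegree Q 1) :
    IsMaurerCartan α ↔ IsLaxPrestack (α 0 2) (α 1 1) (α 2 0) := by
  constructor
  · intro h
    have h' : ∀ p q r, maurerCartan α.toTot p q r = 0 := fun p q r =>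
      congrFun (congrFun (congrFun h p) q) r
    exact ⟨(maurerCartan_zero_three_eq_zero_iff hα).1 (h' 0 3 0),
      (maurerCartan_one_two_eq_zero_iff hα).1 (h' 1 2 1),
      (maurerCartan_two_one_eq_zero_iff hα).1 (h' 2 1 1),
      (maurerCartan_three_zero_eq_zero_iff hα).1 (h' 3 0 1)⟩
  · rintro ⟨h₁, h₂, h₃, h₄⟩
    funext p q r
    by_cases h : (p, q, r) ∈ ({(0, 3, 0), (1, 2, 1), (2, 1, 1), (3, 0, 1)} : Set (ℕ × ℕ × ℕ))
    · simp only [Set.mem_insert_iff, Set.mem_singleton_iff, Prod.mk.injEq] at h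
      rcases h with ⟨rfl, rfl, rfl⟩ | ⟨rfl, rfl, rfl⟩ | ⟨rfl, rfl, rfl⟩ | ⟨rfl, rfl, rfl⟩
      · exact (maurerCartan_zero_three_eq_zero_iff hα).2 h₁
      · exact (maurerCartan_one_two_eq_zero_iff hα).2 h₂
      · exact (maurerCartan_two_one_eq_zero_iff hα).2 h₃
      · exact (maurerCartan_three_zero_eq_zero_iff hα).2 h₄
    · exact maurerCartan_apply_eq_zero hα h

end MaurerCartan

end BoxOperad

theorem mainTheorem4 {k : Type*} [CommRing k] {C : Type*} [CategoryTheory.Category C]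
    (Q : BoxOperad.KQuiver k C) (α : BoxOperad.GSObject Q) (hα : α ∈ BoxOperad.gsDegree Q 1) :
    (BoxOperad.IsMaurerCartan α ↔ BoxOperad.IsLaxPrestack (α 0 2) (α 1 1) (α 2 0)) ∧
    (BoxOperad.maurerCartan α.toTot 0 3 0 = 0 ↔ BoxOperad.IsAssociative (α 0 2)) ∧
    (BoxOperad.maurerCartan α.toTot 1 2 1 = 0 ↔ BoxOperad.IsFunctorial (α 0 2) (α 1 1)) ∧
    (BoxOperad.maurerCartan α.toTot 2 1 1 = 0 ↔
      BoxOperad.IsNatural (α 0 2) (α 1 1) (α 2 0)) ∧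
    (BoxOperad.maurerCartan α.toTot 3 0 1 = 0 ↔
      BoxOperad.IsCoherent (α 0 2) (α 1 1) (α 2 0)) ∧
    (∀ p q r : ℕ, (p, q, r) ∉ ({(0, 3, 0), (1, 2, 1), (2, 1, 1), (3, 0, 1)} : Set (ℕ × ℕ × ℕ)) →
      BoxOperad.maurerCartan α.toTot p q r = 0) ∧
    ∀ n : ℕ, 5 ≤ n → BoxOperad.brace n (fun _ => α.toTot) = 0 :=
  ⟨BoxOperad.isMaurerCartan_iff hα, BoxOperad.maurerCartan_zero_three_eq_zero_iff hα,
    BoxOperad.maurerCartan_one_two_eq_zero_iff hα, BoxOperad.maurerCartan_two_one_eq_zero_iff hα,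
    BoxOperad.maurerCartan_three_zero_eq_zero_iff hα,
    fun _ _ _ => BoxOperad.maurerCartan_apply_eq_zero hα,
    fun _ => BoxOperad.brace_eq_zero fun _ _ _ => BoxOperad.GSObject.toTot_eq_zero hα⟩
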